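/- Let $d_0=184$, the discriminant of the real quadratic field $K=\mathbb{Q}(\sqrt{184})=\mathbb{Q}(\sqrt{46})$. For an integer $f\ge 1$ let $\mathcal{O}_f=\mathbb{Z}\bigl[1,f\tfrac{d_0+\sqrt{d_0}}{2}\bigr]$ be the order of conductor $f$ in $K$ (so $\mathcal{O}_1$ is the maximal order), and define: - $h(d_0f^2)$, the number of classes of invertible fractional ideals of $\mathcal{O}_f$ modulo principal fractional ideals; - $h_+(d_0f^2)$, the number of classes of invertible fractional ideals of $\mathcal{O}_f$ modulo principal fractional ideals generated by a totally positive element of $K$ (one that is positive under both embeddings $K\to\mathbb{R}$); - $H(d)$, for a positive nonsquare discriminant $d$, the number of $SL(2,\mathbb{Z})$-equivalence classes of integral binary quadratic forms $ax^2+bxy+cy^2$ with $\gcd(a,b,c)=1$ and $b^2-4ac=d$. Then for every integer $f>1$, $$\frac{h(184f^2)}{h(184)}=\frac{h_+(184f^2)}{h_+(184)}=\frac{H(184f^2)}{H(184)}>1 .$$ In particular, no order $\mathcal{O}_f$ with $f>1$ has relative ideal class number $h(184f^2)/h(184)$ equal to one. -/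

import Mathlib

open scoped nonZeroDivisors

noncomputable section

/-! ### Orders of real quadratic fields -/

/-- For a positive fundamental discriminant `d₀`, the order `ℤ[1, f (d₀ + √d₀) / 2]` of conductor
`f ≥ 1` in the real quadratic field `ℚ(√d₀) ⊆ ℝ`; for `f = 1` it is the maximal order. -/
def quadOrder (d₀ f : ℕ) : Subalgebra ℤ ℝ :=
  Algebra.adjoin ℤ {(f : ℝ) * (((d₀ : ℝ) + √(d₀ : ℝ)) / 2)}

/-! ### Ideal class numbers -/

/-- The totally positive elements of a (totally real) field `K`: those that are positive under
every embedding of `K` into `ℝ`, as a subgroup of `Kˣ`. -/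
def totallyPositive (K : Type*) [Field K] : Subgroup Kˣ where
  carrier := {x | ∀ σ : K →+* ℝ, 0 < σ (x : K)}
  one_mem' σ := by simp
  mul_mem' {x y} hx hy σ := by
    rw [Units.val_mul, map_mul]
    exact mul_pos (hx σ) (hy σ)
  inv_mem' {x} hx σ := by
    rw [Units.val_inv_eq_inv_val, map_inv₀]
    exact inv_pos.mpr (hx σ)

/-- The strict (narrow) class group of a domain: the invertible fractional ideals modulo the
principal fractional ideals that have a totally positive generator. -/
abbrev StrictClassGroup (R : Type*) [CommRing R] [IsDomain R] : Type _ :=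
  (FractionalIdeal R⁰ (FractionRing R))ˣ ⧸
    (totallyPositive (FractionRing R)).map (toPrincipalIdeal R (FractionRing R))

/-- The ideal class number `h(d₀ f²)`: the number of classes of invertible ideals of the order of
conductor `f`, modulo principal ideals. -/
def idealClassNumber (d₀ f : ℕ) : ℕ := Nat.card (ClassGroup (quadOrder d₀ f))

/-- The strict ideal class number `h₊(d₀ f²)`. -/
def strictIdealClassNumber (d₀ f : ℕ) : ℕ := Nat.card (StrictClassGroup (quadOrder d₀ f))

/-! ### Form class numbers -/

/-- An integral binary quadratic form `a x² + b x y + c y²`. -/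
@[ext]
structure BinaryForm where
  a : ℤ
  b : ℤ
  c : ℤ

namespace BinaryForm

/-- The value `Q(x, y)`. -/
def eval (Q : BinaryForm) (x y : ℤ) : ℤ := Q.a * x ^ 2 + Q.b * x * y + Q.c * y ^ 2

/-- The discriminant `b² - 4 a c`. -/
def disc (Q : BinaryForm) : ℤ := Q.b ^ 2 - 4 * Q.a * Q.c

/-- Properly primitive forms: `gcd(a, b, c) = 1`. -/
def IsPrimitive (Q : BinaryForm) : Prop := Int.gcd (Int.gcd Q.a Q.b) Q.c = 1

/-- Proper equivalence: the forms agree up to a change of variables in `SL(2, ℤ)`. -/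
def ProperlyEquivalent (Q Q' : BinaryForm) : Prop :=
  ∃ γ : Matrix.SpecialLinearGroup (Fin 2) ℤ, ∀ x y : ℤ,
    Q'.eval x y = Q.eval (γ 0 0 * x + γ 0 1 * y) (γ 1 0 * x + γ 1 1 * y)

theorem properlyEquivalent_equivalence : Equivalence ProperlyEquivalent where
  refl Q := ⟨1, fun x y => by simp⟩
  symm := by
    rintro Q Q' ⟨γ, h⟩
    refine ⟨γ⁻¹, fun x y => ?_⟩
    have hd : γ 0 0 * γ 1 1 - γ 0 1 * γ 1 0 = 1 := by
      rw [← Matrix.det_fin_two]; exact γ.det_coe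
    have e : ∀ u v : ℤ, γ⁻¹ 0 0 * u + γ⁻¹ 0 1 * v = γ 1 1 * u - γ 0 1 * v ∧
        γ⁻¹ 1 0 * u + γ⁻¹ 1 1 * v = γ 0 0 * v - γ 1 0 * u := by
      intro u v
      rw [Matrix.SpecialLinearGroup.SL2_inv_expl]
      constructor <;> simp <;> ring
    rw [(e x y).1, (e x y).2, h]
    congr 1
    · linear_combination (-x) * hd
    · linear_combination (-y) * hd
  trans := by
    rintro Q Q' Q'' ⟨γ, h⟩ ⟨δ, k⟩
    refine ⟨γ * δ, fun x y => ?_⟩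
    rw [k, h]
    simp only [Matrix.SpecialLinearGroup.coe_mul, Matrix.mul_apply, Fin.sum_univ_two]
    congr 1 <;> ring

/-- Proper equivalence on the properly primitive forms of discriminant `d`. -/
def formSetoid (d : ℤ) : Setoid {Q : BinaryForm // Q.IsPrimitive ∧ Q.disc = d} :=
  Setoid.comap Subtype.val ⟨ProperlyEquivalent, properlyEquivalent_equivalence⟩

end BinaryForm

/-- The quadratic form class number `H(d)` of a positive nonsquare discriminant `d`: the number of
proper equivalence classes of properly primitive forms of discriminant `d`. -/
def formClassNumber (d : ℤ) : ℕ := Nat.card (Quotient (BinaryForm.formSetoid d))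

/-! ### Relative class numbers -/

/-- The relative ideal class number `h(d₀ f²) / h(d₀)`. -/
def relIdealClassNumber (d₀ f : ℕ) : ℚ :=
  (idealClassNumber d₀ f : ℚ) / (idealClassNumber d₀ 1 : ℚ)

/-- The relative strict ideal class number `h₊(d₀ f²) / h₊(d₀)`. -/
def relStrictIdealClassNumber (d₀ f : ℕ) : ℚ :=
  (strictIdealClassNumber d₀ f : ℚ) / (strictIdealClassNumber d₀ 1 : ℚ)

/-- The relative quadratic form class number `H(d₀ f²) / H(d₀)`. -/
def relFormClassNumber (d₀ f : ℕ) : ℚ :=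
  (formClassNumber ((d₀ : ℤ) * (f : ℤ) ^ 2) : ℚ) / (formClassNumber (d₀ : ℤ) : ℚ)

end

/-!
Sending an invertible ideal to the norm form of a positively oriented `ℤ`-basis matches strict ideal
classes with form classes, so `h₊ = H`. Since `-1` is not a square modulo `23`, no unit has norm
`-1`, whence `h₊ = 2 h` for every conductor; thus all three relative class numbers agree, and it
remains to compare `H(184 f²)` with `H(184)`.

Every form of discriminant `184` represents `1` or `-1`, and a form representing a unit is
determined up to proper equivalence by that unit and the discriminant; hence `H(184) ≤ 2`.
For `f > 1` the forms `±(x² - 46 f² y²)` and `(t² - 46) x² + 2 f t x y + f² y²` are pairwise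
inequivalent as soon as `t² - 46` is prime to `23 f` and not of the form `u² - 46 f² v²`.
If `f` has a prime factor `p ≠ 23`, such a `t` is found by making `t² - 46` a nonresidue modulo `p`
(modulo `8` if `p = 2`).
If `f` is a power of `23`, take `t = 7`: dividing a solution of `u² - 46 w² = 3` with `23 ∣ w` by
`7 ± √46` would give a solution of the Pell equation `x² - 46 y² = 1` with `23 ∤ y`, whereas `23`
divides the second coordinate of `24335 + 3588 √46` and so that of every solution.
-/

/-! ### Binary quadratic forms -/

theorem exists_abs_add_two_mul_mul_le {a : ℤ} (b : ℤ) (ha : a ≠ 0) :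
    ∃ k : ℤ, |b + 2 * a * k| ≤ |a| := by
  have hpos : 0 < 2 * |a| := by positivity
  have hnonneg := Int.emod_nonneg (b + |a|) hpos.ne'
  have hlt := Int.emod_lt_of_pos (b + |a|) hpos
  have hdiv := Int.emod_add_mul_ediv (b + |a|) (2 * |a|)
  set m := (b + |a|) / (2 * |a|)
  obtain ⟨k, hk⟩ : ∃ k, a * k = -(|a| * m) := by
    rcases abs_choice a with h | h <;> rw [h]
    exacts [⟨-m, by ring⟩, ⟨m, by ring⟩]
  exact ⟨k, abs_le.mpr ⟨by linarith, by linarith⟩⟩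

namespace BinaryForm

variable {Q Q' : BinaryForm} {d : ℤ}

/-- The form `Q(p x + q y, r x + s y)` obtained from `Q` by a linear change of variables. -/
def subst (Q : BinaryForm) (p q r s : ℤ) : BinaryForm where
  a := Q.eval p r
  b := 2 * Q.a * p * q + Q.b * (p * s + q * r) + 2 * Q.c * r * s
  c := Q.eval q s

theorem eval_subst (Q : BinaryForm) (p q r s x y : ℤ) :
    (Q.subst p q r s).eval x y = Q.eval (p * x + q * y) (r * x + s * y) := by
  simp only [subst, eval]
  ring

theorem disc_subst (Q : BinaryForm) (p q r s : ℤ) :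
    (Q.subst p q r s).disc = (p * s - q * r) ^ 2 * Q.disc := by
  simp only [subst, eval, disc]
  ring

theorem ext_of_eval (h : ∀ x y, Q.eval x y = Q'.eval x y) : Q = Q' := by
  have h₁₀ := h 1 0
  have h₀₁ := h 0 1
  have h₁₁ := h 1 1
  simp only [eval] at h₁₀ h₀₁ h₁₁
  ext <;> linarith

theorem properlyEquivalent_iff_exists_subst :
    Q.ProperlyEquivalent Q' ↔ ∃ p q r s, p * s - q * r = 1 ∧ Q' = Q.subst p q r s := by
  constructor
  · rintro ⟨γ, hγ⟩
    refine ⟨γ 0 0, γ 0 1, γ 1 0, γ 1 1, ?_, ext_of_eval fun x y => by rw [hγ, eval_subst]⟩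
    rw [← Matrix.det_fin_two, γ.det_coe]
  · rintro ⟨p, q, r, s, hdet, rfl⟩
    exact ⟨⟨!![p, q; r, s], by rw [Matrix.det_fin_two_of, hdet]⟩, eval_subst Q p q r s⟩

theorem properlyEquivalent_subst (Q : BinaryForm) {p q r s : ℤ} (h : p * s - q * r = 1) :
    Q.ProperlyEquivalent (Q.subst p q r s) :=
  properlyEquivalent_iff_exists_subst.mpr ⟨p, q, r, s, h, rfl⟩

theorem ProperlyEquivalent.symm (h : Q.ProperlyEquivalent Q') : Q'.ProperlyEquivalent Q :=
  properlyEquivalent_equivalence.symm h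

theorem ProperlyEquivalent.trans {Q'' : BinaryForm} (h : Q.ProperlyEquivalent Q')
    (h' : Q'.ProperlyEquivalent Q'') : Q.ProperlyEquivalent Q'' :=
  properlyEquivalent_equivalence.trans h h'

theorem ProperlyEquivalent.disc_eq (h : Q.ProperlyEquivalent Q') : Q'.disc = Q.disc := by
  obtain ⟨p, q, r, s, hdet, rfl⟩ := properlyEquivalent_iff_exists_subst.mp h
  rw [disc_subst, hdet, one_pow, one_mul]

theorem ProperlyEquivalent.exists_eval_eq (h : Q.ProperlyEquivalent Q') (x y : ℤ) :
    ∃ u v, Q.eval u v = Q'.eval x y :=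
  let ⟨_, hγ⟩ := h
  ⟨_, _, (hγ x y).symm⟩

theorem isPrimitive_iff :
    Q.IsPrimitive ↔ ∀ l : ℤ, l ∣ Q.a → l ∣ Q.b → l ∣ Q.c → l ∣ 1 := by
  unfold IsPrimitive
  constructor
  · intro h l ha hb hc
    simpa only [h, Nat.cast_one] using Int.dvd_coe_gcd (Int.dvd_coe_gcd ha hb) hc
  · intro h
    have := h (Int.gcd (Int.gcd Q.a Q.b) Q.c)
      ((Int.gcd_dvd_left _ _).trans (Int.gcd_dvd_left _ _))
      ((Int.gcd_dvd_left _ _).trans (Int.gcd_dvd_right _ _)) (Int.gcd_dvd_right _ _)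
    exact Nat.dvd_one.mp (by exact_mod_cast this)

theorem IsPrimitive.exists_bezout (h : Q.IsPrimitive) :
    ∃ x y z : ℤ, x * Q.a + y * Q.b + z * Q.c = 1 := by
  have hgcd := Int.gcd_eq_gcd_ab (Int.gcd Q.a Q.b) Q.c
  rw [h, Int.gcd_eq_gcd_ab Q.a Q.b, Nat.cast_one] at hgcd
  exact ⟨Int.gcdA Q.a Q.b * Int.gcdA _ Q.c, Int.gcdB Q.a Q.b * Int.gcdA _ Q.c, Int.gcdB _ Q.c,
    by linear_combination -hgcd⟩

theorem a_ne_zero_of_not_isSquare_disc (h : ¬ IsSquare Q.disc) : Q.a ≠ 0 := fun ha =>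
  h ⟨Q.b, by rw [disc, ha]; ring⟩

/-! ### Reduction -/

/-- A reduced form, in a weak sense adapted to bounding the coefficients by the discriminant
whatever its sign; a class may contain many reduced forms. -/
def IsReduced (Q : BinaryForm) : Prop := |Q.b| ≤ |Q.a| ∧ |Q.a| ≤ |Q.c|

theorem exists_isReduced (Q : BinaryForm) (hQ : ¬ IsSquare Q.disc) :
    ∃ Q', Q.ProperlyEquivalent Q' ∧ Q'.IsReduced := by
  induction hn : Q.a.natAbs using Nat.strong_induction_on generalizing Q with
  | _ n ih =>
    obtain ⟨k, hk⟩ := exists_abs_add_two_mul_mul_le Q.b (a_ne_zero_of_not_isSquare_disc hQ)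
    have htrans := Q.properlyEquivalent_subst (p := 1) (q := k) (r := 0) (s := 1) (by ring)
    set Q₁ := Q.subst 1 k 0 1 with hQ₁
    have ha : Q₁.a = Q.a := by simp [hQ₁, subst, eval]
    have hb : Q₁.b = Q.b + 2 * Q.a * k := by simp only [hQ₁, subst]; ring
    by_cases hac : |Q₁.a| ≤ |Q₁.c|
    · exact ⟨Q₁, htrans, by rwa [ha, hb], hac⟩
    · have hswap := htrans.trans
        (Q₁.properlyEquivalent_subst (p := 0) (q := -1) (r := 1) (s := 0) (by ring))
      have hlt : (Q₁.subst 0 (-1) 1 0).a.natAbs < n := by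
        rw [not_le, ha] at hac
        have ha' : (Q₁.subst 0 (-1) 1 0).a = Q₁.c := by simp [subst, eval]
        rw [ha', ← hn]
        exact Int.natAbs_lt_iff_sq_lt.mpr (sq_lt_sq.mpr hac)
      obtain ⟨Q', h, hred⟩ := ih _ hlt _ (by rwa [hswap.disc_eq]) rfl
      exact ⟨Q', hswap.trans h, hred⟩

theorem IsReduced.three_mul_abs_le (h : Q.IsReduced) : 3 * |Q.a * Q.c| ≤ |Q.disc| := by
  have hb : Q.b ^ 2 ≤ |Q.a * Q.c| := by
    rw [← sq_abs, sq, abs_mul]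
    exact mul_le_mul h.1 (h.1.trans h.2) (abs_nonneg _) (abs_nonneg _)
  rw [disc]
  rcases abs_cases (Q.a * Q.c) with hac | hac <;>
    rcases abs_cases (Q.b ^ 2 - 4 * Q.a * Q.c) with hd | hd <;> nlinarith

theorem finite_setOf_isReduced (hd : ¬ IsSquare d) :
    {Q : BinaryForm | Q.IsReduced ∧ Q.disc = d}.Finite := by
  have hbox := (Set.finite_Icc (-|d|) |d|)
  refine ((hbox.prod (hbox.prod hbox)).image fun t => (⟨t.1, t.2.1, t.2.2⟩ : BinaryForm)).subset ?_
  rintro Q ⟨hred, rfl⟩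
  have ha : 1 ≤ |Q.a| := Int.one_le_abs (a_ne_zero_of_not_isSquare_disc hd)
  have hc : |Q.c| ≤ |Q.disc| := by
    have := hred.three_mul_abs_le
    rw [abs_mul] at this
    nlinarith [abs_nonneg Q.c]
  exact ⟨(Q.a, Q.b, Q.c), ⟨abs_le.mp (hred.2.trans hc),
    abs_le.mp (hred.1.trans (hred.2.trans hc)), abs_le.mp hc⟩, rfl⟩

theorem eq_of_out_properlyEquivalent {C C' : Quotient (formSetoid d)}
    (h : C.out.1.ProperlyEquivalent C'.out.1) : C = C' :=
  Quotient.out_equiv_out.mp h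

theorem finite_formClasses (hd : ¬ IsSquare d) : Finite (Quotient (formSetoid d)) := by
  have hred (C : Quotient (formSetoid d)) :
      ∃ Q ∈ {Q : BinaryForm | Q.IsReduced ∧ Q.disc = d}, C.out.1.ProperlyEquivalent Q := by
    obtain ⟨Q, h, hQ⟩ := exists_isReduced C.out.1 (by rwa [C.out.2.2])
    exact ⟨Q, ⟨hQ, h.disc_eq.trans C.out.2.2⟩, h⟩
  choose F hF hCF using hred
  have := (finite_setOf_isReduced hd).to_subtype
  refine Finite.of_injective (fun C => (⟨F C, hF C⟩ : {Q | Q.IsReduced ∧ Q.disc = d}))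
    fun C C' h => eq_of_out_properlyEquivalent ((hCF C).trans ?_)
  rw [Subtype.mk.inj h]
  exact (hCF C').symm

/-! ### Forms representing a unit -/

theorem exists_properlyEquivalent_mk_of_eval_eq {x y : ℤ} {e : ℤˣ} (h : Q.eval x y = e) :
    ∃ b c, Q.ProperlyEquivalent ⟨e, b, c⟩ := by
  have he : (e : ℤ) * e = 1 := Int.units_coe_mul_self e
  have hdet : x * (e * (Q.a * x + Q.b * y)) - -(e * (Q.c * y)) * y = 1 := by
    rw [eval] at h
    linear_combination e * h + he
  have hQ := Q.properlyEquivalent_subst hdet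
  rw [subst, h] at hQ
  exact ⟨_, _, hQ⟩

theorem properlyEquivalent_of_a_eq_unit {e : ℤˣ} {b c b' c' : ℤ}
    (h : (⟨e, b, c⟩ : BinaryForm).disc = (⟨e, b', c'⟩ : BinaryForm).disc) :
    (⟨e, b, c⟩ : BinaryForm).ProperlyEquivalent ⟨e, b', c'⟩ := by
  have he : (e : ℤ) * e = 1 := Int.units_coe_mul_self e
  simp only [disc] at h
  obtain ⟨k, hk⟩ : 2 ∣ b' - b := by
    have : Even (b' ^ 2 - b ^ 2) := ⟨2 * e * (c' - c), by linear_combination -h⟩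
    rw [Int.even_sub, Int.even_pow' two_ne_zero, Int.even_pow' two_ne_zero, ← Int.even_sub] at this
    exact this.two_dvd
  refine properlyEquivalent_iff_exists_subst.mpr ⟨1, e * k, 0, 1, by ring, ?_⟩
  ext
  · simp [subst, eval]
  · simp only [subst]
    linear_combination hk - 2 * k * he
  · apply mul_left_cancel₀ four_ne_zero
    simp only [subst, eval]
    linear_combination e * h + e * (b' + b + 2 * k) * hk + (4 * c - 4 * c' - 4 * e * k ^ 2) * he

theorem properlyEquivalent_of_eval_eq_unit (hd : Q.disc = Q'.disc) {x y x' y' : ℤ} {e : ℤˣ}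
    (h : Q.eval x y = e) (h' : Q'.eval x' y' = e) : Q.ProperlyEquivalent Q' := by
  obtain ⟨b, c, hQ⟩ := exists_properlyEquivalent_mk_of_eval_eq h
  obtain ⟨b', c', hQ'⟩ := exists_properlyEquivalent_mk_of_eval_eq h'
  exact (hQ.trans (properlyEquivalent_of_a_eq_unit
    (by rw [hQ.disc_eq, hQ'.disc_eq, hd]))).trans hQ'.symm

/-! ### Discriminant `184` -/

theorem IsReduced.exists_eval_eq_unit_of_disc_eq_184 (h : Q.IsReduced) (hd : Q.disc = 184) :
    ∃ (e : ℤˣ) (x y : ℤ), Q.eval x y = e := by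
  obtain ⟨a, b, c⟩ := Q
  have hac : 3 * (|a| * |c|) ≤ 184 := by simpa [hd, abs_mul] using h.three_mul_abs_le
  obtain ⟨hba, hac'⟩ := h
  simp only [disc, eval] at *
  have ha : |a| ≤ 7 := by nlinarith [abs_nonneg a]
  have ha0 : a ≠ 0 := by
    rintro rfl
    simp_all
  have hc : c = (b ^ 2 - 184) / (4 * a) :=
    (Int.ediv_eq_of_eq_mul_right (by positivity) (by linear_combination hd)).symm
  have hcheck : ∀ a ∈ Finset.Icc (-7 : ℤ) 7, ∀ b ∈ Finset.Icc (-7 : ℤ) 7, |b| ≤ |a| →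
      |a| ≤ |(b ^ 2 - 184) / (4 * a)| → b ^ 2 - 4 * a * ((b ^ 2 - 184) / (4 * a)) = 184 →
      ∃ e : ℤˣ, ∃ q ∈ [((1 : ℤ), (0 : ℤ)), (2, 1), (2, -1), (4, 5), (4, -5), (14, 9), (14, -9),
        (78, 23)], a * q.1 ^ 2 + b * q.1 * q.2 + (b ^ 2 - 184) / (4 * a) * q.2 ^ 2 = e := by
    decide +kernel
  obtain ⟨e, q, -, hq⟩ := hcheck a (Finset.mem_Icc.mpr (abs_le.mp ha)) b
    (Finset.mem_Icc.mpr (abs_le.mp (hba.trans ha))) hba (hc ▸ hac') (hc ▸ hd)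
  exact ⟨e, q.1, q.2, by rwa [hc]⟩

end BinaryForm

theorem formClassNumber_le_two_of_forall_eval_eq_unit {d : ℤ}
    (h : ∀ Q : BinaryForm, Q.disc = d → ∃ (e : ℤˣ) (x y : ℤ), Q.eval x y = e) :
    formClassNumber d ≤ 2 := by
  have hclass (C : Quotient (BinaryForm.formSetoid d)) := h C.out.1 C.out.2.2
  choose e x y he using hclass
  have hinj : Function.Injective e := fun C C' hCC' =>
    BinaryForm.eq_of_out_properlyEquivalent (BinaryForm.properlyEquivalent_of_eval_eq_unit
      (C.out.2.2.trans C'.out.2.2.symm) (he C) (hCC' ▸ he C'))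
  exact (Nat.card_le_card_of_injective e hinj).trans (by simp)

theorem formClassNumber_184_le_two : formClassNumber 184 ≤ 2 :=
  formClassNumber_le_two_of_forall_eval_eq_unit fun Q hQ => by
    obtain ⟨Q', h, hred⟩ := Q.exists_isReduced (by rw [hQ]; norm_num)
    obtain ⟨e, x, y, he⟩ := hred.exists_eval_eq_unit_of_disc_eq_184 (h.disc_eq.trans hQ)
    obtain ⟨u, v, huv⟩ := h.exists_eval_eq x y
    exact ⟨e, u, v, huv.trans he⟩

theorem card_quotient_eq_of_relation {α β : Type*} (s : Setoid α) (t : Setoid β)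
    (r : α → β → Prop) (hα : ∀ a, ∃ b, r a b) (hβ : ∀ b, ∃ a, r a b)
    (h : ∀ a a' b b', r a b → r a' b' → (s a a' ↔ t b b')) :
    Nat.card (Quotient s) = Nat.card (Quotient t) := by
  choose F hF using hα
  refine Nat.card_congr (Equiv.ofBijective
    (Quotient.map F fun a a' haa' => (h a a' _ _ (hF a) (hF a')).mp haa') ⟨?_, ?_⟩)
  · rintro ⟨a⟩ ⟨a'⟩ haa'
    exact Quotient.sound ((h a a' _ _ (hF a) (hF a')).mpr (Quotient.exact haa'))
  · rintro ⟨b⟩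
    obtain ⟨a, ha⟩ := hβ b
    exact ⟨Quotient.mk s a, Quotient.sound ((h a a _ _ (hF a) ha).mp (s.refl a))⟩

/-! ### Fractional ideals -/

section FractionalIdeals

variable {R K : Type*} [CommRing R] [Field K] [Algebra R K] [IsFractionRing R K]

theorem exists_algebraMap_eq_of_mul_mem (I : (FractionalIdeal R⁰ K)ˣ) {t : K}
    (ht : ∀ z ∈ (I : FractionalIdeal R⁰ K), t * z ∈ (I : FractionalIdeal R⁰ K)) :
    ∃ r : R, algebraMap R K r = t := by
  have hle : FractionalIdeal.spanSingleton R⁰ t * (I : FractionalIdeal R⁰ K) ≤ I := fun z hz => by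
    obtain ⟨w, hw, rfl⟩ := FractionalIdeal.mem_singleton_mul.mp hz
    exact ht w hw
  have hle_one : FractionalIdeal.spanSingleton R⁰ t ≤ 1 := by
    have := mul_le_mul_left hle ((I⁻¹ : (FractionalIdeal R⁰ K)ˣ) : FractionalIdeal R⁰ K)
    rwa [mul_assoc, Units.mul_inv, mul_one] at this
  exact (FractionalIdeal.mem_one_iff _).mp
    (hle_one (FractionalIdeal.mem_spanSingleton_self _ t))

theorem spanSingleton_neg_eq (l : K) :
    FractionalIdeal.spanSingleton R⁰ (-l) = FractionalIdeal.spanSingleton R⁰ l := by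
  have hle (k : K) :
      FractionalIdeal.spanSingleton R⁰ (-k) ≤ FractionalIdeal.spanSingleton R⁰ k := by
    rw [FractionalIdeal.spanSingleton_le_iff_mem, FractionalIdeal.mem_spanSingleton]
    exact ⟨-1, by simp⟩
  exact le_antisymm (hle l) (by simpa using hle (-l))

-- The inverse is `(1, β' / a)`: the product of the two ideals is `(a, β, β', c)`.
theorem isUnit_spanSingleton_add_of_mul_eq {a c β β' x y z : R} (ha : algebraMap R K a ≠ 0)
    (hβ : β * β' = a * c) (hone : x * a + y * (β + β') + z * c = 1) :
    IsUnit (FractionalIdeal.spanSingleton R⁰ (algebraMap R K a) +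
      FractionalIdeal.spanSingleton R⁰ (algebraMap R K β)) := by
  have hmul : algebraMap R K a * (algebraMap R K β' / algebraMap R K a) = algebraMap R K β' :=
    mul_div_cancel₀ _ ha
  have hmul' : algebraMap R K β * (algebraMap R K β' / algebraMap R K a) = algebraMap R K c := by
    rw [← mul_div_assoc, ← map_mul, hβ, map_mul, mul_div_cancel_left₀ _ ha]
  refine IsUnit.of_mul_eq_one (FractionalIdeal.spanSingleton R⁰ 1 +
    FractionalIdeal.spanSingleton R⁰ (algebraMap R K β' / algebraMap R K a)) ?_
  simp only [add_mul, mul_add, FractionalIdeal.spanSingleton_mul_spanSingleton, mul_one, hmul,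
    hmul']
  simp only [← FractionalIdeal.coeIdeal_span_singleton, ← FractionalIdeal.coeIdeal_sup,
    ← Ideal.span_union, FractionalIdeal.coeIdeal_eq_one]
  rw [Ideal.one_eq_top, Ideal.eq_top_iff_one, ← hone]
  refine Ideal.add_mem _ (Ideal.add_mem _ (Ideal.mul_mem_left _ _ ?_)
    (Ideal.mul_mem_left _ _ (Ideal.add_mem _ ?_ ?_))) (Ideal.mul_mem_left _ _ ?_)
  all_goals exact Ideal.subset_span (by simp)

end FractionalIdeals

/-! ### Real quadratic orders -/

/-- A presentation of `R`, with field of fractions `K`, as the real quadratic order `ℤ[ω]` of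
discriminant `D`, where `ω` is a root of `X² - tr X + nm`; the two embeddings of `K` into `ℝ`
send `ω` to `(tr ± √D) / 2`. -/
structure RealQuadraticOrder (D : ℤ) (R K : Type*) [CommRing R] [Field K] [Algebra R K] where
  ω : R
  tr : ℤ
  nm : ℤ
  ω_mul_self : ω * ω = tr * ω - nm
  tr_sq_sub : tr ^ 2 - 4 * nm = D
  exists_coord : ∀ r : R, ∃ x y : ℤ, r = x + y * ω
  σ₁ : K →+* ℝ
  σ₂ : K →+* ℝ
  σ₁_ω : σ₁ (algebraMap R K ω) = (tr + √(D : ℝ)) / 2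
  σ₂_ω : σ₂ (algebraMap R K ω) = (tr - √(D : ℝ)) / 2
  pos : 0 < D
  not_isSquare : ¬ IsSquare D

namespace RealQuadraticOrder

variable {D : ℤ} {R K : Type*} [CommRing R] [Field K] [Algebra R K]
  (O : RealQuadraticOrder D R K)

theorem sqrt_pos (O : RealQuadraticOrder D R K) : 0 < √(D : ℝ) :=
  Real.sqrt_pos.mpr (by exact_mod_cast O.pos)

theorem sqrt_mul_sqrt (O : RealQuadraticOrder D R K) : √(D : ℝ) * √(D : ℝ) = D :=
  Real.mul_self_sqrt (by exact_mod_cast O.pos.le)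

theorem charZero (O : RealQuadraticOrder D R K) : CharZero K := O.σ₁.charZero

theorem eq_zero_of_add_mul_ω_eq_zero {x y : ℤ} (h : (x : K) + y * algebraMap R K O.ω = 0) :
    x = 0 ∧ y = 0 := by
  have h₁ := congrArg O.σ₁ h
  have h₂ := congrArg O.σ₂ h
  simp only [map_add, map_mul, map_intCast, map_zero, O.σ₁_ω, O.σ₂_ω] at h₁ h₂
  have hy : y = 0 := by
    have : (y : ℝ) * √(D : ℝ) = 0 := by linear_combination h₁ - h₂
    exact_mod_cast (mul_eq_zero.mp this).resolve_right O.sqrt_pos.ne'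
  subst hy
  exact ⟨by simpa using h₁, rfl⟩

theorem algebraMap_ω_ne_intCast (n : ℤ) : algebraMap R K O.ω ≠ n := fun h => by
  have := O.eq_zero_of_add_mul_ω_eq_zero (x := -n) (y := 1) (by rw [h]; push_cast; ring)
  exact one_ne_zero this.2

/-- The square root `2 ω - tr` of the discriminant. -/
def δ : K := 2 * algebraMap R K O.ω - O.tr

theorem δ_mul_self : O.δ * O.δ = D := by
  have hω := congrArg (algebraMap R K) O.ω_mul_self
  have hD := congrArg (Int.cast : ℤ → K) O.tr_sq_sub
  simp only [map_mul, map_sub, map_intCast] at hω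
  push_cast at hD
  rw [δ]
  linear_combination 4 * hω + hD

theorem σ₁_δ : O.σ₁ O.δ = √(D : ℝ) := by
  rw [δ, map_sub, map_mul, map_ofNat, O.σ₁_ω, map_intCast]
  ring

theorem σ₂_δ : O.σ₂ O.δ = -√(D : ℝ) := by
  rw [δ, map_sub, map_mul, map_ofNat, O.σ₂_ω, map_intCast]
  ring

/-- The norm of `K` over `ℚ`, with values in `ℝ`. -/
def norm : K →*₀ ℝ := O.σ₁.toMonoidWithZeroHom * O.σ₂.toMonoidWithZeroHom

theorem norm_apply (z : K) : O.norm z = O.σ₁ z * O.σ₂ z := rfl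

theorem norm_δ : O.norm O.δ = -D := by
  rw [norm_apply, σ₁_δ, σ₂_δ, mul_neg, O.sqrt_mul_sqrt]

theorem norm_δ_neg : O.norm O.δ < 0 := by
  rw [norm_δ, neg_lt_zero]
  exact_mod_cast O.pos

theorem exists_norm_mul_pos {a : ℝ} (ha : a ≠ 0) : ∃ l : K, 0 < O.norm l * a := by
  rcases ha.lt_or_gt with ha | ha
  · exact ⟨O.δ, mul_pos_of_neg_of_neg O.norm_δ_neg ha⟩
  · exact ⟨1, by rwa [map_one, one_mul]⟩

theorem δ_ne_zero : O.δ ≠ 0 := fun h => by simpa [h] using O.norm_δ_neg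

-- Multiplication by a number of negative norm exchanges the two signs of the norm.
theorem index_eq_two_of_forall_mem_iff {H : Subgroup Kˣ}
    (hH : ∀ l : Kˣ, l ∈ H ↔ 0 < O.norm (l : K)) : H.index = 2 := by
  refine Subgroup.index_eq_two_iff.mpr ⟨Units.mk0 O.δ O.δ_ne_zero, fun b => ?_⟩
  have hb : O.norm (b : K) ≠ 0 := (map_ne_zero O.norm).mpr b.ne_zero
  rw [hH, hH, Units.val_mul, Units.val_mk0, map_mul]
  rcases hb.lt_or_gt with hb | hb
  · exact Or.inl ⟨mul_pos_of_neg_of_neg hb O.norm_δ_neg, hb.not_gt⟩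
  · exact Or.inr ⟨hb, (mul_neg_of_pos_of_neg hb O.norm_δ_neg).not_gt⟩

theorem norm_algebraMap (x y : ℤ) :
    O.norm (algebraMap R K (x + y * O.ω)) = (x ^ 2 + O.tr * x * y + O.nm * y ^ 2 : ℤ) := by
  have hD := congrArg (Int.cast : ℤ → ℝ) O.tr_sq_sub
  simp only [norm_apply, map_add, map_mul, map_intCast, O.σ₁_ω, O.σ₂_ω]
  push_cast at hD ⊢
  linear_combination (y ^ 2 / 4) * (hD - O.sqrt_mul_sqrt)

/-- The signed area of the parallelogram spanned by `u` and `v` in the plane `K ⊗ ℝ`. -/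
def area (u v : K) : ℝ := O.σ₁ u * O.σ₂ v - O.σ₁ v * O.σ₂ u

theorem area_swap (u v : K) : O.area v u = -O.area u v := by
  rw [area, area]
  ring

theorem area_mul_mul (l u v : K) : O.area (l * u) (l * v) = O.norm l * O.area u v := by
  simp only [area, norm_apply, map_mul]
  ring

theorem area_add_add (p q r s : ℤ) (u v : K) :
    O.area (p * u + r * v) (q * u + s * v) = (p * s - q * r : ℤ) * O.area u v := by
  simp only [area, map_add, map_mul, map_intCast]
  push_cast
  ring

theorem area_sub_δ_div_two (a b : ℤ) : O.area a ((b - O.δ) / 2) = a * √(D : ℝ) := by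
  simp only [area, map_div₀, map_sub, map_intCast, map_ofNat, σ₁_δ, σ₂_δ]
  ring

variable {O} in
theorem eq_zero_of_area_ne_zero {u v : K} (h : O.area u v ≠ 0) {x y : ℤ}
    (hxy : (x : K) * u + y * v = 0) : x = 0 ∧ y = 0 := by
  have h₁ := congrArg O.σ₁ hxy
  have h₂ := congrArg O.σ₂ hxy
  simp only [map_add, map_mul, map_intCast, map_zero] at h₁ h₂
  have hx : (x : ℝ) * O.area u v = 0 := by
    rw [area]
    linear_combination O.σ₂ v * h₁ - O.σ₁ v * h₂
  have hy : (y : ℝ) * O.area u v = 0 := by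
    rw [area]
    linear_combination O.σ₁ u * h₂ - O.σ₂ u * h₁
  exact ⟨by simpa [h] using hx, by simpa [h] using hy⟩

/-! ### Norm forms -/

/-- The form `Q` is proportional to the norm form `N(x u + y v)`. This is expressed through the
matrix of multiplication by `δ` on the basis `u`, `v`, which equals that of `√(disc Q)` acting on
the two roots of `Q`. -/
def IsNormForm (Q : BinaryForm) (u v : K) : Prop :=
  O.δ * u = Q.b * u - 2 * Q.a * v ∧ O.δ * v = 2 * Q.c * u - Q.b * v

theorem isNormForm_sub_δ_div_two {Q : BinaryForm} (hQ : Q.disc = D) :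
    O.IsNormForm Q Q.a ((Q.b - O.δ) / 2) := by
  have := O.charZero
  have hD : (Q.b : K) ^ 2 - 4 * Q.a * Q.c = D := by
    exact_mod_cast congrArg (Int.cast : ℤ → K) hQ
  exact ⟨by ring, by linear_combination (-1 / 2) * O.δ_mul_self + (1 / 2) * hD⟩

variable {O} {Q Q' : BinaryForm} {u v : K}

theorem IsNormForm.mul_left (h : O.IsNormForm Q u v) (l : K) :
    O.IsNormForm Q (l * u) (l * v) :=
  ⟨by linear_combination l * h.1, by linear_combination l * h.2⟩

theorem IsNormForm.subst (h : O.IsNormForm Q u v) {p q r s : ℤ} (hdet : p * s - q * r = 1) :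
    O.IsNormForm (Q.subst p q r s) (p * u + r * v) (q * u + s * v) := by
  have hdet' : (p : K) * s - q * r = 1 := by exact_mod_cast congrArg (Int.cast : ℤ → K) hdet
  simp only [IsNormForm, BinaryForm.subst, BinaryForm.eval]
  push_cast
  constructor
  · linear_combination p * h.1 + r * h.2 -
      (p * (Q.b * u - 2 * Q.a * v) + r * (2 * Q.c * u - Q.b * v)) * hdet'
  · linear_combination q * h.1 + s * h.2 -
      (q * (Q.b * u - 2 * Q.a * v) + s * (2 * Q.c * u - Q.b * v)) * hdet'

theorem IsNormForm.eq (h : O.IsNormForm Q u v) (h' : O.IsNormForm Q' u v)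
    (huv : O.area u v ≠ 0) : Q = Q' := by
  obtain ⟨hb, ha⟩ := eq_zero_of_area_ne_zero (x := Q.b - Q'.b) (y := 2 * (Q'.a - Q.a)) huv
    (by push_cast; linear_combination h'.1 - h.1)
  obtain ⟨hc, -⟩ := eq_zero_of_area_ne_zero (x := 2 * (Q.c - Q'.c)) (y := Q'.b - Q.b) huv
    (by push_cast; linear_combination h'.2 - h.2)
  ext <;> linarith

theorem IsNormForm.a_mul_area (h : O.IsNormForm Q u v) :
    Q.a * O.area u v = √(D : ℝ) * O.norm u := by
  have h₁ := congrArg O.σ₁ h.1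
  have h₂ := congrArg O.σ₂ h.1
  simp only [map_sub, map_mul, map_intCast, map_ofNat, σ₁_δ, σ₂_δ] at h₁ h₂
  rw [area, norm_apply]
  linear_combination (O.σ₁ u * h₂ - O.σ₂ u * h₁) / 2

theorem IsNormForm.norm_ne_zero (h : O.IsNormForm Q u v) (ha : Q.a ≠ 0) (huv : O.area u v ≠ 0) :
    O.norm u ≠ 0 := fun hu => by
  have harea := h.a_mul_area
  rw [hu, mul_zero] at harea
  exact mul_ne_zero (Int.cast_ne_zero.mpr ha) huv harea

theorem IsNormForm.mul_eq_mul {u' v' : K} (h : O.IsNormForm Q u v) (h' : O.IsNormForm Q u' v')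
    (ha : Q.a ≠ 0) : u * v' = u' * v := by
  have := O.charZero
  apply mul_left_cancel₀ (mul_ne_zero two_ne_zero (Int.cast_ne_zero.mpr ha) : (2 * Q.a : K) ≠ 0)
  linear_combination u * h'.1 - u' * h.1

theorem IsNormForm.ω_mul (h : O.IsNormForm Q u v) (hQ : Q.disc = D) :
    ∃ p s : ℤ, p - s = Q.b ∧ algebraMap R K O.ω * u = p * u - Q.a * v ∧
      algebraMap R K O.ω * v = Q.c * u + s * v := by
  have := O.charZero
  obtain ⟨p, hp⟩ : 2 ∣ O.tr + Q.b := by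
    have hD := O.tr_sq_sub
    rw [BinaryForm.disc] at hQ
    have : Even (O.tr ^ 2 + Q.b ^ 2) :=
      ⟨O.tr ^ 2 - 2 * O.nm + 2 * Q.a * Q.c, by linear_combination hQ - hD⟩
    rw [Int.even_add, Int.even_pow' two_ne_zero, Int.even_pow' two_ne_zero, ← Int.even_add] at this
    exact this.two_dvd
  have hp' : (O.tr : K) + Q.b = 2 * p := by exact_mod_cast congrArg (Int.cast : ℤ → K) hp
  obtain ⟨h₁, h₂⟩ := h
  rw [δ] at h₁ h₂
  refine ⟨p, p - Q.b, by ring, ?_, ?_⟩ <;> apply mul_left_cancel₀ (two_ne_zero' K)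
  · linear_combination h₁ + u * hp'
  · push_cast
    linear_combination h₂ + v * hp'

/-! ### Lattice bases of fractional ideals -/

/-- The elements `u` and `v` generate the fractional ideal `I` as an abelian group. -/
def IsGeneratedBy (I : FractionalIdeal R⁰ K) (u v : K) : Prop :=
  ∀ z, z ∈ I ↔ ∃ x y : ℤ, z = x * u + y * v

namespace IsGeneratedBy

variable {I I' : FractionalIdeal R⁰ K} {u' v' : K}

theorem left_mem (h : IsGeneratedBy I u v) : u ∈ I := (h u).mpr ⟨1, 0, by simp⟩

theorem right_mem (h : IsGeneratedBy I u v) : v ∈ I := (h v).mpr ⟨0, 1, by simp⟩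

theorem swap (h : IsGeneratedBy I u v) : IsGeneratedBy I v u := fun z => by
  rw [h z, exists_comm]
  simp only [add_comm]

theorem subst (h : IsGeneratedBy I u v) {p q r s : ℤ} (hdet : p * s - q * r = 1) :
    IsGeneratedBy I (p * u + r * v) (q * u + s * v) := by
  have hdet' : (p : K) * s - q * r = 1 := by exact_mod_cast congrArg (Int.cast : ℤ → K) hdet
  intro z
  rw [h z]
  constructor
  · rintro ⟨x, y, rfl⟩
    refine ⟨s * x - q * y, p * y - r * x, ?_⟩
    push_cast
    linear_combination (-(x * u) - y * v) * hdet'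
  · rintro ⟨x, y, rfl⟩
    refine ⟨p * x + q * y, r * x + s * y, ?_⟩
    push_cast
    ring

theorem exists_det_eq_one (h : IsGeneratedBy I u v) (h' : IsGeneratedBy I u' v')
    (ho : 0 < O.area u v) (ho' : 0 < O.area u' v') :
    ∃ p q r s : ℤ, p * s - q * r = 1 ∧ u' = p * u + r * v ∧ v' = q * u + s * v := by
  obtain ⟨p, r, hu'⟩ := (h u').mp h'.left_mem
  obtain ⟨q, s, hv'⟩ := (h v').mp h'.right_mem
  obtain ⟨p', r', hu⟩ := (h' u).mp h.left_mem
  obtain ⟨q', s', hv⟩ := (h' v).mp h.right_mem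
  have harea : O.area u' v' = (p * s - q * r : ℤ) * O.area u v := by
    rw [hu', hv', area_add_add]
  have harea' : O.area u v = (p' * s' - q' * r' : ℤ) * O.area u' v' := by
    conv_lhs => rw [hu, hv]
    rw [area_add_add]
  have hunit : (p * s - q * r) * (p' * s' - q' * r') = 1 := by
    have : ((p * s - q * r : ℤ) : ℝ) * (p' * s' - q' * r' : ℤ) = 1 := by
      apply mul_right_cancel₀ ho'.ne'
      rw [mul_assoc, ← harea', ← harea, one_mul]
    exact_mod_cast this
  have hpos : 0 < p * s - q * r := by
    rw [harea] at ho'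
    exact_mod_cast pos_of_mul_pos_left ho' ho.le
  refine ⟨p, q, r, s, ?_, hu', hv'⟩
  exact (Int.eq_one_or_neg_one_of_mul_eq_one hunit).resolve_right (by omega)

theorem ideal_eq (h : IsGeneratedBy I u v) (h' : IsGeneratedBy I' u v) : I = I' :=
  FractionalIdeal.ext fun z => (h z).trans (h' z).symm

variable [IsFractionRing R K]

theorem spanSingleton_mul (h : IsGeneratedBy I u v) (l : K) :
    IsGeneratedBy (FractionalIdeal.spanSingleton R⁰ l * I) (l * u) (l * v) := fun z => by
  rw [FractionalIdeal.mem_singleton_mul]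
  constructor
  · rintro ⟨w, hw, rfl⟩
    obtain ⟨x, y, rfl⟩ := (h w).mp hw
    exact ⟨x, y, by ring⟩
  · rintro ⟨x, y, rfl⟩
    exact ⟨x * u + y * v, (h _).mpr ⟨x, y, rfl⟩, by ring⟩

end IsGeneratedBy

theorem IsNormForm.isGeneratedBy [IsFractionRing R K] (h : O.IsNormForm Q u v)
    (hQ : Q.disc = D) :
    IsGeneratedBy (FractionalIdeal.spanSingleton R⁰ u + FractionalIdeal.spanSingleton R⁰ v)
      u v := by
  obtain ⟨p, s, -, hu, hv⟩ := h.ω_mul hQ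
  intro z
  rw [FractionalIdeal.mem_add]
  constructor
  · rintro ⟨_, hi, _, hj, rfl⟩
    obtain ⟨r, rfl⟩ := (FractionalIdeal.mem_spanSingleton _).mp hi
    obtain ⟨t, rfl⟩ := (FractionalIdeal.mem_spanSingleton _).mp hj
    obtain ⟨x, y, rfl⟩ := O.exists_coord r
    obtain ⟨x', y', rfl⟩ := O.exists_coord t
    refine ⟨x + y * p + y' * Q.c, x' + y' * s - y * Q.a, ?_⟩
    simp only [Algebra.smul_def, map_add, map_mul, map_intCast]
    push_cast
    linear_combination y * hu + y' * hv
  · rintro ⟨x, y, rfl⟩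
    exact ⟨x * u, (FractionalIdeal.mem_spanSingleton _).mpr ⟨x, by simp [Algebra.smul_def]⟩,
      y * v, (FractionalIdeal.mem_spanSingleton _).mpr ⟨y, by simp [Algebra.smul_def]⟩, rfl⟩

/-! ### The form class of an ideal -/

variable (O) in
/-- `Q` is a norm form of `I` with respect to a positively oriented basis. -/
def Represents (I : FractionalIdeal R⁰ K) (Q : BinaryForm) : Prop :=
  ∃ u v, IsGeneratedBy I u v ∧ 0 < O.area u v ∧ O.IsNormForm Q u v

namespace Represents

variable {I I' : FractionalIdeal R⁰ K}

theorem of_properlyEquivalent (h : O.Represents I Q) (hQ : Q.ProperlyEquivalent Q') :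
    O.Represents I Q' := by
  obtain ⟨u, v, hI, ho, hN⟩ := h
  obtain ⟨p, q, r, s, hdet, rfl⟩ := BinaryForm.properlyEquivalent_iff_exists_subst.mp hQ
  refine ⟨_, _, hI.subst hdet, ?_, hN.subst hdet⟩
  rwa [area_add_add, hdet, Int.cast_one, one_mul]

theorem properlyEquivalent (h : O.Represents I Q) (h' : O.Represents I Q') :
    Q.ProperlyEquivalent Q' := by
  obtain ⟨u, v, hI, ho, hN⟩ := h
  obtain ⟨u', v', hI', ho', hN'⟩ := h'
  obtain ⟨p, q, r, s, hdet, rfl, rfl⟩ := hI.exists_det_eq_one hI' ho ho'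
  rw [hN'.eq (hN.subst hdet) ho'.ne']
  exact Q.properlyEquivalent_subst hdet

variable [IsFractionRing R K]

theorem spanSingleton_mul (h : O.Represents I Q) {l : K} (hl : 0 < O.norm l) :
    O.Represents (FractionalIdeal.spanSingleton R⁰ l * I) Q := by
  obtain ⟨u, v, hI, ho, hN⟩ := h
  refine ⟨_, _, hI.spanSingleton_mul l, ?_, hN.mul_left l⟩
  rw [area_mul_mul]
  exact mul_pos hl ho

theorem exists_eq_spanSingleton_mul (h : O.Represents I Q) (h' : O.Represents I' Q)
    (ha : Q.a ≠ 0) :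
    ∃ l : K, 0 < O.norm l ∧ I' = FractionalIdeal.spanSingleton R⁰ l * I := by
  obtain ⟨u, v, hI, ho, hN⟩ := h
  obtain ⟨u', v', hI', ho', hN'⟩ := h'
  have hnorm : O.norm u ≠ 0 := hN.norm_ne_zero ha ho.ne'
  have hu : u ≠ 0 := (map_ne_zero O.norm).mp hnorm
  have hu' : u' = u' / u * u := (div_mul_cancel₀ u' hu).symm
  have hv' : v' = u' / u * v := by
    rw [div_mul_eq_mul_div, eq_div_iff hu, mul_comm, hN.mul_eq_mul hN' ha]
  have hquot : O.norm (u' / u) = O.area u' v' / O.area u v := by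
    rw [map_div₀, div_eq_div_iff hnorm ho.ne']
    apply mul_left_cancel₀ O.sqrt_pos.ne'
    linear_combination O.area u' v' * hN.a_mul_area - O.area u v * hN'.a_mul_area
  refine ⟨u' / u, ?_, ?_⟩
  · rw [hquot]
    exact div_pos ho' ho
  · rw [hu', hv'] at hI'
    exact hI'.ideal_eq (hI.spanSingleton_mul _)

end Represents

/-! ### Ideal classes and form classes -/

section Existence

variable {I : FractionalIdeal R⁰ K}

theorem nonempty_basis (O : RealQuadraticOrder D R K) : Nonempty (Module.Basis (Fin 2) ℤ R) := by
  have hli : LinearIndependent ℤ ![1, O.ω] := LinearIndependent.pair_iff.mpr fun x y hxy =>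
    O.eq_zero_of_add_mul_ω_eq_zero (by simpa using congrArg (algebraMap R K) hxy)
  refine ⟨Module.Basis.mk hli fun r _ => ?_⟩
  obtain ⟨x, y, rfl⟩ := O.exists_coord r
  rw [Matrix.range_cons_cons_empty, Submodule.mem_span_pair]
  exact ⟨x, y, by simp⟩

theorem exists_isGeneratedBy [IsFractionRing R K] (O : RealQuadraticOrder D R K) (hI : I ≠ 0) :
    ∃ u v, IsGeneratedBy I u v := by
  have : IsDomain R := (IsFractionRing.injective R K).isDomain (algebraMap R K)
  obtain ⟨a, J, -, rfl⟩ := FractionalIdeal.exists_eq_spanSingleton_mul I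
  have hJ : J ≠ ⊥ := by
    rintro rfl
    simp at hI
  let b := J.selfBasis O.nonempty_basis.some hJ
  have hb : IsGeneratedBy (J : FractionalIdeal R⁰ K) (algebraMap R K (b 0))
      (algebraMap R K (b 1)) := fun z => by
    rw [FractionalIdeal.mem_coeIdeal]
    constructor
    · rintro ⟨r, hr, rfl⟩
      have := congrArg (fun r : J => algebraMap R K r) (b.sum_repr ⟨r, hr⟩)
      rw [Fin.sum_univ_two] at this
      exact ⟨b.repr ⟨r, hr⟩ 0, b.repr ⟨r, hr⟩ 1, by simpa using this.symm⟩
    · rintro ⟨x, y, rfl⟩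
      exact ⟨x * b 0 + y * b 1, J.add_mem (J.mul_mem_left _ (b 0).2) (J.mul_mem_left _ (b 1).2),
        by simp⟩
  exact ⟨_, _, hb.spanSingleton_mul _⟩

theorem IsGeneratedBy.exists_mul_eq (h : IsGeneratedBy I u v) {w : K} (hw : w ∈ I) (r : R) :
    ∃ x y : ℤ, algebraMap R K r * w = x * u + y * v :=
  (h _).mp (by rw [← Algebra.smul_def]; exact I.coeToSubmodule.smul_mem r hw)

theorem IsGeneratedBy.left_ne_zero (O : RealQuadraticOrder D R K) (h : IsGeneratedBy I u v)
    (hI : I ≠ 0) : u ≠ 0 := by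
  rintro rfl
  obtain ⟨x, s, hs⟩ := h.exists_mul_eq h.right_mem O.ω
  rw [mul_zero, zero_add] at hs
  have hv : v = 0 := by
    by_contra hv
    exact O.algebraMap_ω_ne_intCast s (mul_right_cancel₀ hv hs)
  subst hv
  refine hI (FractionalIdeal.ext fun z => ?_)
  simp [h z]

theorem IsGeneratedBy.exists_isNormForm (h : IsGeneratedBy I u v) (hI : I ≠ 0) :
    ∃ Q : BinaryForm, Q.disc = D ∧ O.IsNormForm Q u v := by
  obtain ⟨p, q, hu⟩ := h.exists_mul_eq h.left_mem O.ω
  obtain ⟨r, s, hv⟩ := h.exists_mul_eq h.right_mem O.ω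
  have hω : algebraMap R K O.ω * algebraMap R K O.ω = O.tr * algebraMap R K O.ω - O.nm := by
    simpa using congrArg (algebraMap R K) O.ω_mul_self
  -- Cayley–Hamilton for multiplication by `ω` on the basis `u`, `v`.
  obtain ⟨hdet, htr⟩ := O.eq_zero_of_add_mul_ω_eq_zero (x := p * s - q * r - O.nm)
    (y := O.tr - p - s) (by
      apply mul_right_cancel₀ (mul_ne_zero (h.left_ne_zero O hI) (h.swap.left_ne_zero O hI))
      push_cast
      linear_combination -u * v * hω + (algebraMap R K O.ω - s) * v * hu + q * v * hv)
  have htr' : (O.tr : K) = p + s := by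
    rw [show O.tr = p + s by linarith]
    push_cast
    rfl
  refine ⟨⟨-q, p - s, r⟩, ?_, ?_, ?_⟩
  · rw [BinaryForm.disc, ← O.tr_sq_sub]
    linear_combination (-O.tr - p - s) * htr - 4 * hdet
  all_goals
    rw [δ, htr']
    push_cast
  · linear_combination 2 * hu
  · linear_combination 2 * hv

theorem IsNormForm.area_ne_zero (h : O.IsNormForm Q u v) (hu : u ≠ 0) :
    O.area u v ≠ 0 := fun h0 => by
  have harea := h.a_mul_area
  rw [h0, mul_zero, eq_comm, mul_eq_zero, map_eq_zero] at harea
  exact harea.elim O.sqrt_pos.ne' hu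

end Existence

variable [IsFractionRing R K]

-- If `l` divides `Q`, then `(ω - p) / l` maps the ideal into itself, hence lies in the order.
theorem IsNormForm.isPrimitive {I : (FractionalIdeal R⁰ K)ˣ} (h : O.IsNormForm Q u v)
    (hI : IsGeneratedBy (I : FractionalIdeal R⁰ K) u v) (hQ : Q.disc = D) : Q.IsPrimitive := by
  have := O.charZero
  refine BinaryForm.isPrimitive_iff.mpr fun l ⟨a, ha⟩ ⟨b, hb⟩ ⟨c, hc⟩ => ?_
  obtain ⟨p, s, hps, hu, hv⟩ := h.ω_mul hQ
  have hl : (l : K) ≠ 0 := by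
    rintro hl
    rw [Int.cast_eq_zero.mp hl, zero_mul] at ha hb
    exact O.not_isSquare ⟨0, by rw [← hQ, BinaryForm.disc, ha, hb]; ring⟩
  have hps' : (p : K) - s = l * b := by exact_mod_cast congrArg (Int.cast : ℤ → K) (hps.trans hb)
  rw [ha] at hu
  rw [hc] at hv
  push_cast at hu hv
  obtain ⟨r, hr⟩ : ∃ r : R, algebraMap R K r = (algebraMap R K O.ω - p) / l := by
    refine exists_algebraMap_eq_of_mul_mem I fun z hz => ?_
    obtain ⟨x, y, rfl⟩ := (hI z).mp hz
    refine (hI _).mpr ⟨y * c, -(x * a) - y * b, ?_⟩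
    rw [div_mul_eq_mul_div, div_eq_iff hl]
    push_cast
    linear_combination x * hu + y * hv - y * v * hps'
  obtain ⟨x, y, rfl⟩ := O.exists_coord r
  rw [eq_div_iff hl] at hr
  simp only [map_add, map_mul, map_intCast] at hr
  have hy := (O.eq_zero_of_add_mul_ω_eq_zero (x := l * x + p) (y := l * y - 1) (by
    push_cast
    linear_combination hr)).2
  exact ⟨y, by linarith⟩

variable (O)

theorem exists_represents (I : (FractionalIdeal R⁰ K)ˣ) :
    ∃ Q : BinaryForm, (Q.IsPrimitive ∧ Q.disc = D) ∧
      O.Represents (I : FractionalIdeal R⁰ K) Q := by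
  have hI : (I : FractionalIdeal R⁰ K) ≠ 0 := I.ne_zero
  obtain ⟨u, v, huv, ho⟩ :
      ∃ u v, IsGeneratedBy (I : FractionalIdeal R⁰ K) u v ∧ 0 < O.area u v := by
    obtain ⟨u, v, huv⟩ := O.exists_isGeneratedBy hI
    obtain ⟨Q, -, hN⟩ := huv.exists_isNormForm (O := O) hI
    rcases (hN.area_ne_zero (huv.left_ne_zero O hI)).lt_or_gt with ho | ho
    · exact ⟨v, u, huv.swap, by rw [area_swap]; exact neg_pos.mpr ho⟩
    · exact ⟨u, v, huv, ho⟩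
  obtain ⟨Q, hQ, hN⟩ := huv.exists_isNormForm (O := O) hI
  exact ⟨Q, ⟨hN.isPrimitive huv hQ, hQ⟩, u, v, huv, ho, hN⟩

theorem isUnit_spanSingleton_add_sub_δ_div_two (hprim : Q.IsPrimitive) (hQ : Q.disc = D) :
    IsUnit (FractionalIdeal.spanSingleton R⁰ (Q.a : K) +
      FractionalIdeal.spanSingleton R⁰ ((Q.b - O.δ) / 2)) := by
  have := O.charZero
  have ha : (Q.a : K) ≠ 0 :=
    Int.cast_ne_zero.mpr (Q.a_ne_zero_of_not_isSquare_disc (hQ ▸ O.not_isSquare))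
  obtain ⟨hN₁, hN₂⟩ := O.isNormForm_sub_δ_div_two hQ
  obtain ⟨p, -, -, hω, -⟩ := IsNormForm.ω_mul ⟨hN₁, hN₂⟩ hQ
  have hβ : (Q.b - O.δ) / 2 = algebraMap R K (p - O.ω) := by
    apply mul_left_cancel₀ ha
    simp only [map_sub, map_intCast]
    linear_combination hω
  have hmul : (p - O.ω) * (Q.b - (p - O.ω)) = Q.a * Q.c := by
    apply IsFractionRing.injective R K
    simp only [map_mul, map_sub _ (Q.b : R), ← hβ, map_intCast]
    linear_combination (1 / 2) * hN₂
  obtain ⟨x, y, z, hone⟩ := hprim.exists_bezout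
  have hone' : (x : R) * Q.a + y * (p - O.ω + (Q.b - (p - O.ω))) + z * Q.c = 1 := by
    rw [add_sub_cancel]
    exact_mod_cast congrArg (Int.cast : ℤ → R) hone
  simpa only [← hβ, map_intCast] using
    isUnit_spanSingleton_add_of_mul_eq (K := K) (by rwa [map_intCast]) hmul hone'

theorem exists_represents_of_isPrimitive (hprim : Q.IsPrimitive) (hQ : Q.disc = D) :
    ∃ I : (FractionalIdeal R⁰ K)ˣ, O.Represents (I : FractionalIdeal R⁰ K) Q := by
  have hN := O.isNormForm_sub_δ_div_two hQ
  have hunit := O.isUnit_spanSingleton_add_sub_δ_div_two hprim hQ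
  have ha : (Q.a : ℝ) ≠ 0 :=
    Int.cast_ne_zero.mpr (Q.a_ne_zero_of_not_isSquare_disc (hQ ▸ O.not_isSquare))
  obtain ⟨l, hl⟩ := O.exists_norm_mul_pos ha
  have hl0 : l ≠ 0 := by
    rintro rfl
    simp at hl
  refine ⟨toPrincipalIdeal R K (Units.mk0 l hl0) * hunit.unit, l * Q.a, l * ((Q.b - O.δ) / 2), ?_,
    ?_, hN.mul_left l⟩
  · rw [Units.val_mul, coe_toPrincipalIdeal, hunit.unit_spec]
    exact (hN.isGeneratedBy hQ).spanSingleton_mul l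
  · rw [area_mul_mul, area_sub_δ_div_two, ← mul_assoc]
    exact mul_pos hl O.sqrt_pos

/-! ### Totally positive elements -/

theorem ringHom_ext {L : Type*} [Field L] {σ τ : K →+* L}
    (h : σ (algebraMap R K O.ω) = τ (algebraMap R K O.ω)) : σ = τ := by
  refine IsLocalization.ringHom_ext R⁰ (RingHom.ext fun r => ?_)
  obtain ⟨x, y, rfl⟩ := O.exists_coord r
  simp [h]

theorem eq_σ₁_or_eq_σ₂ (τ : K →+* ℝ) : τ = O.σ₁ ∨ τ = O.σ₂ := by
  have hδ : τ O.δ * τ O.δ = √(D : ℝ) * √(D : ℝ) := by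
    rw [← map_mul, O.δ_mul_self, map_intCast, O.sqrt_mul_sqrt]
  rw [δ, map_sub, map_mul, map_ofNat, map_intCast] at hδ
  refine (mul_self_eq_mul_self_iff.mp hδ).imp (fun h => ?_) fun h => ?_ <;> apply O.ringHom_ext
  · rw [O.σ₁_ω]
    linarith
  · rw [O.σ₂_ω]
    linarith

theorem mem_totallyPositive_iff {l : Kˣ} :
    l ∈ totallyPositive K ↔ 0 < O.σ₁ l ∧ 0 < O.σ₂ l := by
  refine ⟨fun hl => ⟨hl _, hl _⟩, fun ⟨h₁, h₂⟩ τ => ?_⟩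
  rcases O.eq_σ₁_or_eq_σ₂ τ with rfl | rfl
  exacts [h₁, h₂]

theorem exists_mem_totallyPositive {l : K} (hl : 0 < O.norm l) :
    ∃ m ∈ totallyPositive K, (m : K) = l ∨ (m : K) = -l := by
  have hl0 : l ≠ 0 := by
    rintro rfl
    simp at hl
  rcases pos_and_pos_or_neg_and_neg_of_mul_pos hl with ⟨h₁, h₂⟩ | ⟨h₁, h₂⟩
  · exact ⟨Units.mk0 l hl0, O.mem_totallyPositive_iff.mpr ⟨h₁, h₂⟩, Or.inl rfl⟩
  · refine ⟨Units.mk0 (-l) (neg_ne_zero.mpr hl0), O.mem_totallyPositive_iff.mpr ?_, Or.inr rfl⟩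
    simpa using ⟨h₁, h₂⟩

theorem exists_four_mul_norm_eq_of_mem_ker {k : Kˣ} (hk : k ∈ (toPrincipalIdeal R K).ker) :
    ∃ x y n : ℤ, O.norm (k : K) = n ∧ x ^ 2 - D * y ^ 2 = 4 * n := by
  have hk1 : (k : K) ∈ (1 : FractionalIdeal R⁰ K) := by
    rw [← Units.val_one, ← toPrincipalIdeal_eq_iff.mp (MonoidHom.mem_ker.mp hk)]
    exact FractionalIdeal.mem_spanSingleton_self _ _
  obtain ⟨r, hr⟩ := (FractionalIdeal.mem_one_iff _).mp hk1
  obtain ⟨x, y, rfl⟩ := O.exists_coord r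
  exact ⟨2 * x + O.tr * y, y, x ^ 2 + O.tr * x * y + O.nm * y ^ 2,
    by rw [← hr, norm_algebraMap], by linear_combination y ^ 2 * O.tr_sq_sub⟩

theorem norm_eq_one_of_mem_ker (hneg : ∀ x y : ℤ, x ^ 2 - D * y ^ 2 ≠ -4) {k : Kˣ}
    (hk : k ∈ (toPrincipalIdeal R K).ker) : O.norm (k : K) = 1 := by
  obtain ⟨x, y, n, hn, hxy⟩ := O.exists_four_mul_norm_eq_of_mem_ker hk
  obtain ⟨-, -, n', hn', -⟩ := O.exists_four_mul_norm_eq_of_mem_ker (inv_mem hk)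
  have hone : n * n' = 1 := by
    have : (n : ℝ) * n' = 1 := by rw [← hn, ← hn', ← map_mul, Units.mul_inv, map_one]
    exact_mod_cast this
  rcases Int.eq_one_or_neg_one_of_mul_eq_one hone with rfl | rfl
  · rw [hn, Int.cast_one]
  · exact absurd hxy (hneg x y)

theorem mem_totallyPositive_sup_ker_iff (hneg : ∀ x y : ℤ, x ^ 2 - D * y ^ 2 ≠ -4) {l : Kˣ} :
    l ∈ totallyPositive K ⊔ (toPrincipalIdeal R K).ker ↔ 0 < O.norm (l : K) := by
  rw [Subgroup.mem_sup]
  constructor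
  · rintro ⟨t, ht, k, hk, rfl⟩
    obtain ⟨h₁, h₂⟩ := O.mem_totallyPositive_iff.mp ht
    rw [Units.val_mul, map_mul, O.norm_eq_one_of_mem_ker hneg hk, mul_one]
    exact mul_pos h₁ h₂
  · intro hl
    obtain ⟨m, hm, h | h⟩ := O.exists_mem_totallyPositive hl
    · exact ⟨m, hm, 1, one_mem _, by ext; simp [h]⟩
    · refine ⟨m, hm, -1, ?_, by ext; simp [h]⟩
      rw [MonoidHom.mem_ker]
      ext1
      rw [coe_toPrincipalIdeal, Units.val_neg, spanSingleton_neg_eq]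
      simp

/-! ### Comparison of the class numbers -/

section ClassNumbers

variable [IsDomain R]

theorem card_strictClassGroup_eq_formClassNumber
    (O : RealQuadraticOrder D R (FractionRing R)) :
    Nat.card (StrictClassGroup R) = formClassNumber D := by
  refine card_quotient_eq_of_relation _ _
    (fun I Q => O.Represents (I : FractionalIdeal R⁰ (FractionRing R)) Q.1) (fun I => ?_)
    (fun Q => O.exists_represents_of_isPrimitive Q.2.1 Q.2.2) fun I I' Q Q' h h' => ?_
  · obtain ⟨Q, hQ, h⟩ := O.exists_represents I
    exact ⟨⟨Q, hQ⟩, h⟩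
  · rw [QuotientGroup.leftRel_apply]
    constructor
    · rintro ⟨l, hl, hlI⟩
      have hpos := O.mem_totallyPositive_iff.mp hl
      have h'' := h.spanSingleton_mul (l := l) (mul_pos hpos.1 hpos.2)
      have hI' : I' = toPrincipalIdeal R (FractionRing R) l * I := by
        rw [hlI, mul_comm, mul_inv_cancel_left]
      rw [← coe_toPrincipalIdeal, ← Units.val_mul, ← hI'] at h''
      exact h''.properlyEquivalent h'
    · intro hQ
      have ha : Q'.1.a ≠ 0 :=
        Q'.1.a_ne_zero_of_not_isSquare_disc (by rw [Q'.2.2]; exact O.not_isSquare)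
      obtain ⟨l, hl, hI⟩ := (h.of_properlyEquivalent hQ).exists_eq_spanSingleton_mul h' ha
      obtain ⟨m, hm, hml⟩ := O.exists_mem_totallyPositive hl
      refine ⟨m, hm, ?_⟩
      rw [eq_inv_mul_iff_mul_eq]
      ext1
      rw [Units.val_mul, coe_toPrincipalIdeal, hI, mul_comm]
      rcases hml with h | h <;> rw [h]
      rw [spanSingleton_neg_eq]

theorem card_strictClassGroup_eq_two_mul_card_classGroup
    (O : RealQuadraticOrder D R (FractionRing R)) (hneg : ∀ x y : ℤ, x ^ 2 - D * y ^ 2 ≠ -4) :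
    Nat.card (StrictClassGroup R) = 2 * Nat.card (ClassGroup R) := by
  have hrel : ((totallyPositive (FractionRing R)).map
      (toPrincipalIdeal R (FractionRing R))).relIndex
        (toPrincipalIdeal R (FractionRing R)).range = 2 := by
    rw [MonoidHom.range_eq_map, Subgroup.relIndex_map_map, top_sup_eq, Subgroup.relIndex_top_right,
      O.index_eq_two_of_forall_mem_iff fun _ => O.mem_totallyPositive_sup_ker_iff hneg]
  have hmul := Subgroup.relIndex_mul_index (Subgroup.map_le_range
    (toPrincipalIdeal R (FractionRing R)) (totallyPositive (FractionRing R)))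
  rw [hrel] at hmul
  exact hmul.symm

end ClassNumbers

end RealQuadraticOrder

/-! ### The orders `quadOrder d₀ f` -/

theorem isSquare_mul_sq_iff {N f : ℤ} (hf : f ≠ 0) : IsSquare (N * f ^ 2) ↔ IsSquare N := by
  refine ⟨fun ⟨r, hr⟩ => ?_, fun h => h.mul (IsSquare.sq f)⟩
  obtain ⟨s, rfl⟩ : f ∣ r := (Int.pow_dvd_pow_iff two_ne_zero).mp ⟨N, by rw [sq r, ← hr, mul_comm]⟩
  exact ⟨s, mul_left_cancel₀ (pow_ne_zero 2 hf) (by linear_combination hr)⟩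

theorem quadraticAlgebra_lift_injective_of_irrational {a b : ℤ} {θ : ℝ} (hθ : Irrational θ)
    (h : θ * θ = a • (1 : ℝ) + b • θ) :
    Function.Injective (QuadraticAlgebra.lift ⟨θ, h⟩ : QuadraticAlgebra ℤ a b →ₐ[ℤ] ℝ) := by
  refine (injective_iff_map_eq_zero _).mpr fun ⟨x, y⟩ hxy => ?_
  simp only [QuadraticAlgebra.lift_apply_apply, zsmul_eq_mul, mul_one] at hxy
  have hy : y = 0 := by
    by_contra hy
    exact ((hθ.intCast_mul hy).intCast_add x).ne_zero hxy
  subst hy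
  obtain rfl : x = 0 := by simpa using hxy
  rfl

theorem range_quadraticAlgebra_lift {R A : Type*} [CommRing R] [Ring A] [Algebra R A] {a b : R}
    {θ : A} (h : θ * θ = a • 1 + b • θ) :
    (QuadraticAlgebra.lift ⟨θ, h⟩ : QuadraticAlgebra R a b →ₐ[R] A).range =
      Algebra.adjoin R {θ} := by
  apply le_antisymm
  · rintro _ ⟨z, rfl⟩
    exact add_mem (Subalgebra.smul_mem _ (one_mem _) _)
      (Subalgebra.smul_mem _ (Algebra.self_mem_adjoin_singleton R θ) _)
  · rw [Algebra.adjoin_le_iff, Set.singleton_subset_iff]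
    exact ⟨QuadraticAlgebra.omega, by simp⟩

section QuadraticAlgebra

variable {R K : Type*} [CommRing R] [Field K] [Algebra R K] [IsFractionRing R K]

theorem exists_ringHom_apply_algebraMap_omega {a b : ℤ} (e : QuadraticAlgebra ℤ a b ≃+* R)
    {θ : ℝ} (hθ : Irrational θ) (h : θ * θ = a • (1 : ℝ) + b • θ) :
    ∃ σ : K →+* ℝ, σ (algebraMap R K (e QuadraticAlgebra.omega)) = θ := by
  have hinj : Function.Injective
      ((QuadraticAlgebra.lift ⟨θ, h⟩ : _ →ₐ[ℤ] ℝ).toRingHom.comp e.symm.toRingHom) :=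
    (quadraticAlgebra_lift_injective_of_irrational hθ h).comp e.symm.injective
  exact ⟨IsFractionRing.lift hinj, by rw [IsFractionRing.lift_algebraMap]; simp⟩

variable {t n D : ℤ}

theorem half_add_mul_self_eq {s : ℝ} (ht : t ^ 2 - 4 * n = D) (hs : s * s = D) :
    (t + s) / 2 * ((t + s) / 2) = (-n) • (1 : ℝ) + t • ((t + s) / 2) := by
  have ht' : (t : ℝ) ^ 2 - 4 * n = D := by exact_mod_cast congrArg (Int.cast : ℤ → ℝ) ht
  simp only [zsmul_eq_mul, Int.cast_neg]
  linear_combination (1 / 4) * (hs - ht')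

theorem nonempty_realQuadraticOrder_of_ringEquiv (e : QuadraticAlgebra ℤ (-n) t ≃+* R)
    (ht : t ^ 2 - 4 * n = D) (hpos : 0 < D) (hD : ¬ IsSquare D) :
    Nonempty (RealQuadraticOrder D R K) := by
  have hirr : Irrational √(D : ℝ) := irrational_sqrt_intCast_iff.mpr ⟨hD, hpos.le⟩
  have hsq : √(D : ℝ) * √(D : ℝ) = D := Real.mul_self_sqrt (by exact_mod_cast hpos.le)
  obtain ⟨σ₁, hσ₁⟩ := exists_ringHom_apply_algebraMap_omega (K := K) e
    ((hirr.intCast_add t).div_natCast two_ne_zero) (half_add_mul_self_eq ht hsq)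
  obtain ⟨σ₂, hσ₂⟩ := exists_ringHom_apply_algebraMap_omega (K := K) e
    ((hirr.neg.intCast_add t).div_natCast two_ne_zero)
    (half_add_mul_self_eq ht ((neg_mul_neg _ _).trans hsq))
  refine ⟨⟨e QuadraticAlgebra.omega, t, n, ?_, ht, fun r => ?_, σ₁, σ₂, hσ₁, ?_, hpos, hD⟩⟩
  · rw [← map_mul, QuadraticAlgebra.omega_mul_omega_eq_add]
    simp only [neg_smul, zsmul_eq_mul, mul_one, map_add, map_neg, map_mul, map_intCast]
    ring
  · obtain ⟨z, rfl⟩ := e.surjective r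
    refine ⟨z.re, z.im, ?_⟩
    conv_lhs => rw [← QuadraticAlgebra.mk_eta z, QuadraticAlgebra.mk_eq_add_smul_omega]
    simp
  · rw [hσ₂, sub_eq_add_neg, Nat.cast_ofNat]

end QuadraticAlgebra

theorem nonempty_ringEquiv_adjoin {a b : ℤ} {θ : ℝ} (hθ : Irrational θ)
    (h : θ * θ = a • (1 : ℝ) + b • θ) :
    Nonempty (QuadraticAlgebra ℤ a b ≃+* Algebra.adjoin ℤ {θ}) :=
  ⟨((AlgEquiv.ofInjective _ (quadraticAlgebra_lift_injective_of_irrational hθ h)).trans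
    (Subalgebra.equivOfEq _ _ (range_quadraticAlgebra_lift h))).toRingEquiv⟩

theorem nonempty_realQuadraticOrder_quadOrder {d₀ f : ℕ} (hd : ¬ IsSquare (d₀ : ℤ))
    (hmod : d₀ % 4 = 0 ∨ d₀ % 4 = 1) (hf : f ≠ 0) :
    Nonempty (RealQuadraticOrder ((d₀ : ℤ) * (f : ℤ) ^ 2) (quadOrder d₀ f)
      (FractionRing (quadOrder d₀ f))) := by
  have hf' : (f : ℤ) ≠ 0 := by exact_mod_cast hf
  have hd₀ : 0 < d₀ := Nat.pos_of_ne_zero fun h => hd (by simp [h])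
  have hD : ¬ IsSquare ((d₀ : ℤ) * (f : ℤ) ^ 2) := by rwa [isSquare_mul_sq_iff hf']
  have hpos : 0 < (d₀ : ℤ) * (f : ℤ) ^ 2 := by positivity
  obtain ⟨m, hm⟩ : (4 : ℤ) ∣ d₀ ^ 2 - d₀ := by
    rw [sq, ← mul_sub_one]
    rcases hmod with h | h
    · exact Dvd.dvd.mul_right (by omega) _
    · exact Dvd.dvd.mul_left (by omega) _
  have ht : (f * d₀ : ℤ) ^ 2 - 4 * (f ^ 2 * m) = d₀ * (f : ℤ) ^ 2 := by
    linear_combination (f : ℤ) ^ 2 * hm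
  have hθ : (f : ℝ) * (((d₀ : ℝ) + √(d₀ : ℝ)) / 2) =
      ((f * d₀ : ℤ) + √(((d₀ : ℤ) * (f : ℤ) ^ 2 : ℤ) : ℝ)) / 2 := by
    push_cast
    rw [Real.sqrt_mul (by positivity), Real.sqrt_sq (by positivity)]
    ring
  have hirr : Irrational √(((d₀ : ℤ) * (f : ℤ) ^ 2 : ℤ) : ℝ) :=
    irrational_sqrt_intCast_iff.mpr ⟨hD, hpos.le⟩
  obtain ⟨e⟩ := nonempty_ringEquiv_adjoin ((hirr.intCast_add (f * d₀)).div_natCast two_ne_zero)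
    (half_add_mul_self_eq ht (Real.mul_self_sqrt (by exact_mod_cast hpos.le)))
  rw [Nat.cast_ofNat, ← hθ] at e
  exact nonempty_realQuadraticOrder_of_ringEquiv e ht hpos hD

section QuadOrder

variable {d₀ f : ℕ}

theorem strictIdealClassNumber_eq_formClassNumber (hd : ¬ IsSquare (d₀ : ℤ))
    (hmod : d₀ % 4 = 0 ∨ d₀ % 4 = 1) (hf : f ≠ 0) :
    strictIdealClassNumber d₀ f = formClassNumber ((d₀ : ℤ) * (f : ℤ) ^ 2) := by
  obtain ⟨O⟩ := nonempty_realQuadraticOrder_quadOrder hd hmod hf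
  exact O.card_strictClassGroup_eq_formClassNumber

theorem strictIdealClassNumber_eq_two_mul_idealClassNumber (hd : ¬ IsSquare (d₀ : ℤ))
    (hmod : d₀ % 4 = 0 ∨ d₀ % 4 = 1) (hf : f ≠ 0)
    (hneg : ∀ x y : ℤ, x ^ 2 - d₀ * f ^ 2 * y ^ 2 ≠ -4) :
    strictIdealClassNumber d₀ f = 2 * idealClassNumber d₀ f := by
  obtain ⟨O⟩ := nonempty_realQuadraticOrder_quadOrder hd hmod hf
  exact O.card_strictClassGroup_eq_two_mul_card_classGroup hneg

end QuadOrder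

/-! ### Numbers `t² - N` not of the form `u² - N w²` -/

theorem not_dvd_sq_add_sq_of_mod_four_eq_three {q : ℕ} [Fact q.Prime] (hq : q % 4 = 3) {s : ℤ}
    (hs : ¬ (q : ℤ) ∣ s) (u : ℤ) : ¬ (q : ℤ) ∣ u ^ 2 + s ^ 2 := by
  rw [← ZMod.intCast_zmod_eq_zero_iff_dvd] at hs ⊢
  intro h
  push_cast at h
  exact ZMod.mod_four_ne_three_of_sq_eq_neg_sq' hs (eq_neg_of_add_eq_zero_left h) hq

theorem exists_sq_sub_not_isSquare {p : ℕ} [Fact p.Prime] (hp : p ≠ 2) {c : ZMod p} (hc : c ≠ 0) :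
    ∃ t : ZMod p, ¬ IsSquare (t ^ 2 - c) := by
  by_contra! h
  obtain ⟨a, ha⟩ := FiniteField.exists_nonsquare (F := ZMod p) (by rwa [ZMod.ringChar_zmod_n])
  have isSquare_neg_mul (k : ℕ) : IsSquare (-(k : ZMod p) * c) := by
    induction k with
    | zero => simp
    | succ k ih =>
      obtain ⟨t, ht⟩ := ih
      convert h t using 1
      push_cast
      linear_combination ht
  obtain ⟨k, hk⟩ := ZMod.natCast_zmod_surjective (-a / c)
  apply ha
  convert isSquare_neg_mul k using 1
  rw [hk]
  field_simp

theorem exists_isCoprime_sq_sub (N : ℤ) {g : ℕ} (hg : g ≠ 0) :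
    ∃ s : ℤ, IsCoprime (s ^ 2 - N) g := by
  refine ⟨∏ l ∈ g.primeFactors with ¬ ((l : ℕ) : ℤ) ∣ N, (l : ℤ), ?_⟩
  refine Int.isCoprime_iff_nat_coprime.mpr (Nat.coprime_of_dvd fun l hl hls hlg => ?_)
  rw [← Int.natCast_dvd] at hls
  rw [Int.natAbs_natCast] at hlg
  have hl' : Prime (l : ℤ) := Nat.prime_iff_prime_int.mp hl
  by_cases hlN : (l : ℤ) ∣ N
  · obtain ⟨k, hk, hlk⟩ := (hl'.dvd_finsetProd_iff _).mp
      (hl'.dvd_of_dvd_pow ((dvd_sub_left hlN).mp hls))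
    rw [Finset.mem_filter, Nat.mem_primeFactors] at hk
    obtain rfl := (Nat.prime_dvd_prime_iff_eq hl hk.1.1).mp (by exact_mod_cast hlk)
    exact hk.2 hlN
  · refine hlN ((dvd_sub_right (Dvd.dvd.pow ?_ two_ne_zero)).mp hls)
    exact Finset.dvd_prod_of_mem _ (Finset.mem_filter.mpr ⟨hl.mem_primeFactors hlg hg, hlN⟩)

theorem exists_modEq_isCoprime_sq_sub {p : ℕ} (hp : p.Prime) {N t₀ : ℤ}
    (ht₀ : ¬ (p : ℤ) ∣ t₀ ^ 2 - N) {f : ℕ} (hf : f ≠ 0) :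
    ∃ t : ℤ, t ≡ t₀ [ZMOD p] ∧ IsCoprime (t ^ 2 - N) f := by
  obtain ⟨c, g, hpg, rfl⟩ := Nat.exists_eq_pow_mul_and_not_dvd hf p hp.ne_one
  have hp' : Prime (p : ℤ) := Nat.prime_iff_prime_int.mp hp
  obtain ⟨s, hs⟩ := exists_isCoprime_sq_sub N (right_ne_zero_of_mul hf)
  obtain ⟨x, y, hxy⟩ := (Prime.coprime_iff_not_dvd hp').mpr
    (by exact_mod_cast hpg : ¬ (p : ℤ) ∣ g)
  have htp : s * (x * p) + t₀ * (y * g) ≡ t₀ [ZMOD p] :=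
    Int.modEq_iff_dvd.mpr ⟨(t₀ - s) * x, by linear_combination (-t₀) * hxy⟩
  have htg : s * (x * p) + t₀ * (y * g) ≡ s [ZMOD g] :=
    Int.modEq_iff_dvd.mpr ⟨(s - t₀) * y, by linear_combination (-s) * hxy⟩
  refine ⟨_, htp, ?_⟩
  push_cast
  refine IsCoprime.mul_right (IsCoprime.pow_right (IsCoprime.symm ?_)) ?_
  · rw [Prime.coprime_iff_not_dvd hp', ((htp.pow 2).sub_right N).dvd_iff]
    exact ht₀
  · obtain ⟨k, hk⟩ := ((htg.pow 2).sub_right N).symm.dvd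
    rw [sub_eq_iff_eq_add'.mp hk]
    exact hs.add_mul_left_left k

theorem exists_isCoprime_forall_sq_sub_ne_of_odd_prime {p : ℕ} [Fact p.Prime] (hp : p ≠ 2) {N : ℤ}
    (hpN : ¬ (p : ℤ) ∣ N) {f : ℕ} (hf : f ≠ 0) :
    ∃ t : ℤ, IsCoprime (t ^ 2 - N) f ∧
      ∀ u w : ℤ, (p : ℤ) ∣ w → u ^ 2 - N * w ^ 2 ≠ t ^ 2 - N := by
  rw [← ZMod.intCast_zmod_eq_zero_iff_dvd] at hpN
  obtain ⟨c, hc⟩ := exists_sq_sub_not_isSquare hp hpN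
  obtain ⟨t₀, rfl⟩ := ZMod.intCast_surjective c
  have ht₀ : ¬ (p : ℤ) ∣ t₀ ^ 2 - N := fun hdvd => hc <| by
    rw [← ZMod.intCast_zmod_eq_zero_iff_dvd] at hdvd
    push_cast at hdvd
    exact hdvd ▸ IsSquare.zero
  obtain ⟨t, htt₀, hcop⟩ := exists_modEq_isCoprime_sq_sub Fact.out ht₀ hf
  refine ⟨t, hcop, fun u w hw h => hc ⟨u, ?_⟩⟩
  have h' := congrArg (Int.cast : ℤ → ZMod p) h
  push_cast at h'
  rw [(ZMod.intCast_zmod_eq_zero_iff_dvd w p).mpr hw, (ZMod.intCast_eq_intCast_iff t t₀ p).mpr htt₀]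
    at h'
  linear_combination -h'

theorem exists_isCoprime_forall_sq_sub_ne_of_two {N : ℤ} (hN : N % 8 = 6) {f : ℕ} (hf : f ≠ 0) :
    ∃ t : ℤ, IsCoprime (t ^ 2 - N) f ∧
      ∀ u w : ℤ, 2 ∣ w → u ^ 2 - N * w ^ 2 ≠ t ^ 2 - N := by
  obtain ⟨t, ht, hcop⟩ := exists_modEq_isCoprime_sq_sub Nat.prime_two (N := N) (t₀ := 1)
    (by push_cast; omega) hf
  refine ⟨t, hcop, ?_⟩
  rintro u _ ⟨v, rfl⟩ h
  have ht8 := Int.eight_dvd_sq_sub_one_of_odd (Int.odd_iff.mpr ht)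
  have hu8 : u ^ 2 % 8 = 3 := by
    obtain ⟨n, rfl⟩ : ∃ n, N = 2 * n := ⟨N / 2, by omega⟩
    have : u ^ 2 = 8 * (n * v ^ 2) + t ^ 2 - 2 * n := by linear_combination h
    omega
  rcases Int.even_or_odd u with ⟨k, rfl⟩ | hu
  · have : (k + k) ^ 2 = 4 * k ^ 2 := by ring
    omega
  · have := Int.eight_dvd_sq_sub_one_of_odd hu
    omega

/-! ### Three form classes -/

section FormClasses

open BinaryForm

theorem formClassNumber_pos {d : ℤ} (hd : ¬ IsSquare d) {Q : BinaryForm} (hQ : Q.IsPrimitive)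
    (hdisc : Q.disc = d) : 0 < formClassNumber d := by
  have := finite_formClasses hd
  have : Nonempty (Quotient (formSetoid d)) := ⟨Quotient.mk _ ⟨Q, hQ, hdisc⟩⟩
  exact Nat.card_pos

theorem two_lt_formClassNumber_of_forall_sq_sub_ne {M : ℤ} (hM : ¬ IsSquare M) {T : BinaryForm}
    (hT : T.IsPrimitive) (hdisc : T.disc = 4 * M) (hone : ∀ u v : ℤ, u ^ 2 - M * v ^ 2 ≠ -1)
    (ha : ∀ u v : ℤ, u ^ 2 - M * v ^ 2 ≠ T.a) (hna : ∀ u v : ℤ, u ^ 2 - M * v ^ 2 ≠ -T.a) :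
    2 < formClassNumber (4 * M) := by
  have hfin := finite_formClasses (d := 4 * M)
    (by rwa [show 4 * M = M * 2 ^ 2 by ring, isSquare_mul_sq_iff two_ne_zero])
  let pos : {Q : BinaryForm // Q.IsPrimitive ∧ Q.disc = 4 * M} :=
    ⟨⟨1, 0, -M⟩, isPrimitive_iff.mpr fun _ hl _ _ => hl, by simp only [disc]; ring⟩
  let neg : {Q : BinaryForm // Q.IsPrimitive ∧ Q.disc = 4 * M} :=
    ⟨⟨-1, 0, M⟩, isPrimitive_iff.mpr fun _ hl _ _ => (dvd_neg.mp hl), by simp only [disc]; ring⟩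
  have hpos_neg : ¬ pos.1.ProperlyEquivalent neg.1 := fun e => by
    obtain ⟨u, v, huv⟩ := e.exists_eval_eq 1 0
    simp only [eval, pos, neg] at huv
    exact hone u v (by linear_combination huv)
  have hpos_T : ¬ pos.1.ProperlyEquivalent T := fun e => by
    obtain ⟨u, v, huv⟩ := e.exists_eval_eq 1 0
    simp only [eval, pos] at huv
    exact ha u v (by linear_combination huv)
  have hneg_T : ¬ neg.1.ProperlyEquivalent T := fun e => by
    obtain ⟨u, v, huv⟩ := e.exists_eval_eq 1 0
    simp only [eval, neg] at huv
    exact hna u v (by linear_combination -huv)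
  have := Fintype.ofFinite (Quotient (formSetoid (4 * M)))
  rw [formClassNumber, Nat.card_eq_fintype_card, Fintype.two_lt_card_iff]
  exact ⟨Quotient.mk _ pos, Quotient.mk _ neg, Quotient.mk _ ⟨T, hT, hdisc⟩,
    fun e => hpos_neg (Quotient.exact e), fun e => hpos_T (Quotient.exact e),
    fun e => hneg_T (Quotient.exact e)⟩

-- The third class is that of `(t² - N, 2ft, f²)`, the form `x² - N y²` precomposed with
-- `(x, y) ↦ (t x + f y, x)`, a matrix of determinant `-f`.
theorem two_lt_formClassNumber_of_isCoprime {q : ℕ} [Fact q.Prime] (hq : q % 4 = 3) {N f t : ℤ}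
    (hN : ¬ IsSquare N) (hqN : (q : ℤ) ∣ N) (hf : f ≠ 0) (hcop : IsCoprime (t ^ 2 - N) (q * f))
    (ht : ∀ u v : ℤ, u ^ 2 - N * (f * v) ^ 2 ≠ t ^ 2 - N) :
    2 < formClassNumber (4 * (N * f ^ 2)) := by
  have hq' : Prime (q : ℤ) := Nat.prime_iff_prime_int.mp Fact.out
  have hqt : ¬ (q : ℤ) ∣ t := fun h => hq'.not_isUnit <|
    hcop.of_mul_right_left.isUnit_of_dvd' ((h.pow two_ne_zero).sub hqN) dvd_rfl
  obtain ⟨n, rfl⟩ := hqN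
  refine two_lt_formClassNumber_of_forall_sq_sub_ne (T := ⟨t ^ 2 - q * n, 2 * f * t, f ^ 2⟩)
    (by rwa [isSquare_mul_sq_iff hf]) ?_ (by simp only [disc]; ring) ?_ ?_ ?_
  · exact isPrimitive_iff.mpr fun l hla _ hlc =>
      ((hcop.of_mul_right_right.pow_right (n := 2)).isUnit_of_dvd' hla hlc).dvd
  · intro u v h
    exact not_dvd_sq_add_sq_of_mod_four_eq_three hq (fun h1 => hq'.not_dvd_one h1) u
      ⟨n * f ^ 2 * v ^ 2, by linear_combination h⟩
  · intro u v h
    exact ht u v (by linear_combination h)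
  · intro u v h
    exact not_dvd_sq_add_sq_of_mod_four_eq_three hq hqt u
      ⟨n * f ^ 2 * v ^ 2 + n, by linear_combination h⟩

end FormClasses

/-! ### Divisibility in the Pell equation -/

section Pell

open Pell Pell.Solution₁

variable {d : ℤ}

theorem pell_pow_x_le_x_pow {a : Solution₁ d} (hd : 0 ≤ d) (hx : 0 < a.x) (hy : 0 < a.y) (n : ℕ) :
    a.x ^ n ≤ (a ^ n).x := by
  induction n with
  | zero => simp
  | succ n ih =>
    have hyn : 0 ≤ (a ^ n).y := by
      cases n with
      | zero => simp
      | succ n => exact (y_pow_succ_pos hx hy n).le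
    rw [pow_succ, pow_succ, x_mul]
    exact (mul_le_mul_of_nonneg_right ih hx.le).trans
      (le_add_of_nonneg_right (mul_nonneg hd (mul_nonneg hyn hy.le)))

section PrimeDivisor

variable {p : ℕ}

theorem pell_cast_y_pow_mul_cast_x (hpd : (p : ℤ) ∣ d) (a : Solution₁ d) (n : ℕ) :
    ((a ^ n).y : ZMod p) * a.x = n * a.x ^ n * a.y := by
  have hd : (d : ZMod p) = 0 := (ZMod.intCast_zmod_eq_zero_iff_dvd d p).mpr hpd
  have cast_x_pow (n : ℕ) : ((a ^ n).x : ZMod p) = a.x ^ n := by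
    induction n with
    | zero => simp
    | succ n ih => rw [pow_succ, x_mul, Int.cast_add, Int.cast_mul d, hd]; simp [ih, pow_succ]
  induction n with
  | zero => simp
  | succ n ih =>
    rw [pow_succ, y_mul, Int.cast_add, Int.cast_mul, Int.cast_mul, cast_x_pow, Nat.cast_succ]
    linear_combination (a.x : ZMod p) * ih

variable [Fact p.Prime]

theorem pell_cast_x_ne_zero (hpd : (p : ℤ) ∣ d) (a : Solution₁ d) : (a.x : ZMod p) ≠ 0 := by
  intro hx
  have h := congrArg (Int.cast : ℤ → ZMod p) a.prop
  push_cast at h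
  rw [hx, (ZMod.intCast_zmod_eq_zero_iff_dvd d p).mpr hpd] at h
  simp at h

theorem dvd_y_of_isFundamental (hpd : (p : ℤ) ∣ d) {a₁ : Solution₁ d} (h₁ : IsFundamental a₁)
    (hy : (p : ℤ) ∣ a₁.y) (a : Solution₁ d) : (p : ℤ) ∣ a.y := by
  rw [← ZMod.intCast_zmod_eq_zero_iff_dvd] at hy ⊢
  have cast_y_pow (n : ℕ) : ((a₁ ^ n).y : ZMod p) = 0 := by
    have h := pell_cast_y_pow_mul_cast_x hpd a₁ n
    rw [hy, mul_zero] at h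
    exact (mul_eq_zero.mp h).resolve_right (pell_cast_x_ne_zero hpd a₁)
  have cast_y_zpow : ∀ n : ℤ, ((a₁ ^ n).y : ZMod p) = 0 := by
    rintro (n | n)
    · simpa using cast_y_pow n
    · rw [zpow_negSucc, y_inv, Int.cast_neg, cast_y_pow, neg_zero]
  obtain ⟨n, rfl | rfl⟩ := h₁.eq_zpow_or_neg_zpow a
  · exact cast_y_zpow n
  · rw [y_neg, Int.cast_neg, cast_y_zpow, neg_zero]

-- A solution with `p ∣ y` is either a power of a solution with `p ∣ y` or a `p`-th power, and
-- the latter has `2 ^ p ≤ x`.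
theorem isFundamental_dvd_y_of_x_lt_two_pow (hpd : (p : ℤ) ∣ d) {a₁ : Solution₁ d}
    (h₁ : IsFundamental a₁) {b : Solution₁ d} (hx : 0 < b.x) (hy : 0 < b.y) (hpy : (p : ℤ) ∣ b.y)
    (hb : b.x < 2 ^ p) : (p : ℤ) ∣ a₁.y := by
  obtain ⟨n, rfl⟩ := h₁.eq_pow_of_nonneg hx hy.le
  have hcast := pell_cast_y_pow_mul_cast_x hpd a₁ n
  rw [(ZMod.intCast_zmod_eq_zero_iff_dvd _ p).mpr hpy, zero_mul] at hcast
  rcases mul_eq_zero.mp hcast.symm with h | h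
  · exfalso
    have hpn : p ∣ n := (ZMod.natCast_eq_zero_iff n p).mp
      ((mul_eq_zero.mp h).resolve_right (pow_ne_zero n (pell_cast_x_ne_zero hpd a₁)))
    have hn : n ≠ 0 := by
      rintro rfl
      simp at hy
    refine hb.not_ge ?_
    calc (2 : ℤ) ^ p ≤ a₁.x ^ p := pow_le_pow_left₀ zero_le_two h₁.1 p
      _ ≤ a₁.x ^ n := pow_le_pow_right₀ h₁.1.le (Nat.le_of_dvd (Nat.pos_of_ne_zero hn) hpn)
      _ ≤ (a₁ ^ n).x := pell_pow_x_le_x_pow h₁.d_pos.le h₁.x_pos h₁.2.1 n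
  · exact (ZMod.intCast_zmod_eq_zero_iff_dvd _ p).mp h

end PrimeDivisor

theorem not_isSquare_fortySix : ¬ IsSquare (46 : ℤ) := by norm_num

theorem twentyThree_dvd_y_of_pell_fortySix (a : Solution₁ 46) : 23 ∣ a.y := by
  have : Fact (Nat.Prime 23) := ⟨by norm_num⟩
  obtain ⟨a₁, h₁⟩ := IsFundamental.exists_of_not_isSquare (by norm_num) not_isSquare_fortySix
  have hy₁ : (23 : ℤ) ∣ a₁.y := isFundamental_dvd_y_of_x_lt_two_pow (p := 23) (by norm_num) h₁
    (b := mk 24335 3588 (by norm_num)) (by simp) (by simp) (by simp) (by simp)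
  exact dvd_y_of_isFundamental (p := 23) (by norm_num) h₁ hy₁ a

-- Since `7² - 46 = 3`, one of the quotients `(u ± w√46) / (7 + √46)` is integral, hence a solution
-- of the Pell equation.
theorem sq_sub_fortySix_mul_sq_ne_three {u w : ℤ} (hw : 23 ∣ w) : u ^ 2 - 46 * w ^ 2 ≠ 3 := by
  intro h
  wlog h3 : 3 ∣ u - w generalizing w
  · refine this (w := -w) (by simpa using hw) (by simpa using h) ?_
    have hdvd : (3 : ℤ) ∣ (u - w) * (u - -w) := ⟨1 + 15 * w ^ 2, by linear_combination h⟩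
    exact (Int.prime_three.dvd_or_dvd hdvd).resolve_left h3
  obtain ⟨k, hk⟩ := h3
  obtain rfl : u = w + 3 * k := by linarith
  have hy := twentyThree_dvd_y_of_pell_fortySix
    (mk (7 * k - 13 * w) (2 * w - k) (by linarith))
  rw [y_mk] at hy
  have h23k : 23 ∣ k := by omega
  have h23 : (23 : ℤ) ∣ (w + 3 * k) ^ 2 - 46 * w ^ 2 :=
    ((hw.add (h23k.mul_left 3)).pow two_ne_zero).sub (Dvd.dvd.mul_right (by norm_num) _)
  rw [h] at h23
  norm_num at h23

end Pell

/-! ### Class numbers of discriminant `184 f²` -/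

theorem exists_isCoprime_forall_sq_sub_fortySix_ne {f : ℕ} (hf : 1 < f) :
    ∃ t : ℤ, IsCoprime (t ^ 2 - 46) (23 * f : ℤ) ∧
      ∀ u v : ℤ, u ^ 2 - 46 * (f * v) ^ 2 ≠ t ^ 2 - 46 := by
  have hf0 : 23 * f ≠ 0 := by omega
  have h23 : Nat.Prime 23 := by norm_num
  by_cases h : ∀ p : ℕ, p.Prime → p ∣ f → p = 23
  · obtain ⟨p, hp, hpf⟩ := Nat.exists_prime_and_dvd hf.ne'
    obtain rfl := h p hp hpf
    refine ⟨7, ?_, fun u v => ?_⟩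
    · have h3f : Nat.Coprime 3 f := (Nat.Prime.coprime_iff_not_dvd Nat.prime_three).mpr
        fun h3 => absurd (h 3 Nat.prime_three h3) (by norm_num)
      rw [show (7 : ℤ) ^ 2 - 46 = (3 : ℕ) by norm_num]
      exact_mod_cast Nat.Coprime.mul_right (by norm_num : Nat.Coprime 3 23) h3f
    · exact sq_sub_fortySix_mul_sq_ne_three (Dvd.dvd.mul_right (by exact_mod_cast hpf) v)
  · push Not at h
    obtain ⟨p, hp, hpf, hp23⟩ := h
    have hpf' (v : ℤ) : (p : ℤ) ∣ f * v := Dvd.dvd.mul_right (by exact_mod_cast hpf) v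
    have : Fact p.Prime := ⟨hp⟩
    obtain ⟨t, hcop, ht⟩ : ∃ t : ℤ, IsCoprime (t ^ 2 - 46) ((23 * f : ℕ) : ℤ) ∧
        ∀ u w : ℤ, (p : ℤ) ∣ w → u ^ 2 - 46 * w ^ 2 ≠ t ^ 2 - 46 := by
      rcases eq_or_ne p 2 with rfl | hp2
      · exact exists_isCoprime_forall_sq_sub_ne_of_two (by norm_num) hf0
      · refine exists_isCoprime_forall_sq_sub_ne_of_odd_prime hp2 (fun hdvd => ?_) hf0
        have hdvd' : p ∣ 2 * 23 := by exact_mod_cast hdvd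
        rcases hp.dvd_mul.mp hdvd' with h2 | h23'
        · exact hp2 ((Nat.prime_dvd_prime_iff_eq hp Nat.prime_two).mp h2)
        · exact hp23 ((Nat.prime_dvd_prime_iff_eq hp h23).mp h23')
    exact ⟨t, by exact_mod_cast hcop, fun u v => ht u _ (hpf' v)⟩

theorem two_lt_formClassNumber_184_mul_sq {f : ℕ} (hf : 1 < f) :
    2 < formClassNumber (184 * (f : ℤ) ^ 2) := by
  have : Fact (Nat.Prime 23) := ⟨by norm_num⟩
  obtain ⟨t, hcop, ht⟩ := exists_isCoprime_forall_sq_sub_fortySix_ne hf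
  rw [show 184 * (f : ℤ) ^ 2 = 4 * (46 * (f : ℤ) ^ 2) by ring]
  exact two_lt_formClassNumber_of_isCoprime (q := 23) (by norm_num) not_isSquare_fortySix
    (by norm_num) (by exact_mod_cast (by omega : f ≠ 0)) hcop ht

theorem sq_sub_184_mul_sq_mul_sq_ne_neg_four (f x y : ℤ) : x ^ 2 - 184 * f ^ 2 * y ^ 2 ≠ -4 := by
  intro h
  have : Fact (Nat.Prime 23) := ⟨by norm_num⟩
  exact not_dvd_sq_add_sq_of_mod_four_eq_three (q := 23) (s := 2) (by norm_num) (by norm_num) x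
    ⟨8 * f ^ 2 * y ^ 2, by push_cast; linear_combination h⟩

theorem theorem1p1 (f : ℕ) (hf : 1 < f) :
    relIdealClassNumber 184 f = relStrictIdealClassNumber 184 f ∧
      relStrictIdealClassNumber 184 f = relFormClassNumber 184 f ∧
      1 < relIdealClassNumber 184 f := by
  have hf0 : f ≠ 0 := by omega
  have h184 : ¬ IsSquare ((184 : ℕ) : ℤ) := by norm_num
  have strict_eq_form {g : ℕ} (hg : g ≠ 0) :=
    strictIdealClassNumber_eq_formClassNumber h184 (.inl rfl) hg
  have strict_eq_two_mul {g : ℕ} (hg : g ≠ 0) :=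
    strictIdealClassNumber_eq_two_mul_idealClassNumber h184 (.inl rfl) hg
      (sq_sub_184_mul_sq_mul_sq_ne_neg_four g)
  have form_one := strict_eq_form one_ne_zero
  rw [Nat.cast_one, one_pow, mul_one] at form_one
  have hpos : 0 < strictIdealClassNumber 184 1 := form_one ▸
    formClassNumber_pos h184 (Q := ⟨1, 0, -46⟩)
      (BinaryForm.isPrimitive_iff.mpr fun _ hl _ _ => hl) rfl
  have hlt : strictIdealClassNumber 184 1 < strictIdealClassNumber 184 f := by
    rw [form_one, strict_eq_form hf0]
    exact formClassNumber_184_le_two.trans_lt (two_lt_formClassNumber_184_mul_sq hf)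
  have ideal_eq_strict : relIdealClassNumber 184 f = relStrictIdealClassNumber 184 f := by
    rw [relIdealClassNumber, relStrictIdealClassNumber, strict_eq_two_mul hf0,
      strict_eq_two_mul one_ne_zero, Nat.cast_mul, Nat.cast_mul, mul_div_mul_left _ _ (by norm_num)]
  refine ⟨ideal_eq_strict, ?_, ?_⟩
  · rw [relStrictIdealClassNumber, relFormClassNumber, strict_eq_form hf0, form_one]
  · rw [ideal_eq_strict, relStrictIdealClassNumber, one_lt_div (by exact_mod_cast hpos)]
    exact_mod_cast hlt
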